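/- Let $n\in\mathbb N$, $0<T<\infty$, let $\Omega\subset\mathbb R^n$ and $\Lambda\subset\mathbb R$ be open, $f:\Lambda\times\Omega\times[0,T]\to\mathbb R^n$, $g:\Omega\times[0,T]\to\mathbb R^n$, and let $h:(-\infty,T]\to\mathbb R$ be left-continuous, of bounded variation on $[0,T]$, with $h(t)=h(0)$ for $t<0$. Write $\|x\|=\sum_i|x_i|$ on $\mathbb R^n$. Assume: (i) $f(\lambda,\cdot,t)$ is continuous on $\Omega$ for all $\lambda\in\Lambda$, $t\in[0,T]$; $f(\lambda,x,\cdot)$ is Lebesgue measurable on $[0,T]$ for all $\lambda\in\Lambda$, $x\in\Omega$; and there is a Lebesgue integrable $m:[0,T]\to[0,\infty)$ with $\|f(\lambda,x,t)\|\le m(t)$ on $\Lambda\times\Omega\times[0,T]$; (ii) $g(\cdot,t)$ is continuous on $\Omega$ for all $t\in[0,T]$, and there is $\widetilde m:[0,T]\to[0,\infty)$ with $\|g(x,t)\|\le\widetilde m(t)$ on $\Omega\times[0,T]$ such that the integral $\int_0^T\widetilde m(t)\,d[\mathrm{var}_0^t h]$ exists and is finite; (iii) the integral $\int_0^T g(x,s)\,dh(s)$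 exists for every $x\in\Omega$, so that $$F(\lambda,x,t)=\int_0^t f(\lambda,x,s)\,ds+\int_0^t g(x,s)\,dh(s)$$ is defined on $\Lambda\times\Omega\times[0,T]$. All integrals with respect to $h$ and $\mathrm{var}_0^t h$ are Kurzweil--Stieltjes integrals, and $\int\cdots ds$ is the Henstock--Kurzweil integral. $\int_a^b DU(\tau,t)$ denotes the Kurzweil integral, i.e. the gauge limit of $\sum_j[U(\tau_j,t_j)-U(\tau_j,t_{j-1})]$ over $\delta$-fine tagged partitions of $[a,b]$. Test functions are the $\varphi\in C^\infty(\mathbb R;\mathbb R^n)$ all of whose derivatives (including $\varphi$ itself) vanish outside $(0,T)$. A function $u\in L^1([0,T];\mathbb R^n)$ is identified with the distribution $\langle u,\varphi\rangle=\int_0^T u\cdot\varphi\,dt$, and $\langle Du,\varphi\rangle=-\langle u,\varphi'\rangle$. If $\int_0^T\gamma\,dh$ exists, the product $\gamma\,.\,Dh$ is the distributional derivative of $t\mapsto\int_0^t\gamma\,dh$. Let $x:[0,T]\to\mathbb R^n$ be regulated (all one-sided limits exist) and $\lambda\in\Lambda$. $\bullet$ $(x,\lambda)$ is a solution of the measure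 differential equation $Dx=f(\lambda,x,t)+g(x,t)\,.\,Dh$ if $x$ has bounded variation on $[0,T]$, is left-continuous on $(0,T]$, has values in $\Omega$, the function $t\mapsto f(\lambda,x(t),t)$ is in $L^1[0,T]$, the product $g(x(t),t)\,.\,Dh$ has a sense, and the equation holds as an equality of distributions. $\bullet$ $(x,\lambda)$ is a solution of the generalized ODE $\frac{dx}{d\tau}=DF(\lambda,x,t)$ if for all $s\in[0,T]$ one has $x(s)\in\Omega$, the integral $\int_0^s DF(\lambda,x(\tau),t)$ exists, and $x(s)=x(0)+\int_0^s DF(\lambda,x(\tau),t)$. Then $(x,\lambda)$ is a solution of the generalized ODE if and only if it is a solution of the measure differential equation and the latter also holds at the initial point $t=0$ (which the test functions do not see), in the sense that $$x(0+)-x(0)=g(x(0),0)\,\bigl(h(0+)-h(0)\bigr).$$ -/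

import Mathlib

open Set Filter Topology MeasureTheory
open scoped ContDiff

namespace MDE

/-- `ℝⁿ` with the norm `‖x‖ = ∑ i, |x i|`. -/
abbrev Rn (n : ℕ) : Type := PiLp 1 (fun _ : Fin n => ℝ)

/-! ### The Kurzweil integral -/

section Kurzweil

variable {X : Type*} [NormedAddCommGroup X]

/-- Tagged partitions of `[a, b]`: division points `a = t₀ ≤ t₁ ≤ ⋯ ≤ t_ν = b` and tags
`τ_j ∈ [t_j, t_{j+1}]` for `j < ν` (the sequences are irrelevant beyond these indices). -/
structure TaggedPartition (a b : ℝ) where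
  ν : ℕ
  pt : ℕ → ℝ
  tag : ℕ → ℝ
  pt_zero : pt 0 = a
  pt_last : pt ν = b
  tag_mem : ∀ j < ν, tag j ∈ Icc (pt j) (pt (j + 1))
  mono : ∀ j < ν, pt j ≤ pt (j + 1)

/-- `P` is `δ`-fine: `[t_j, t_{j+1}] ⊆ (τ_j - δ(τ_j), τ_j + δ(τ_j))` for all `j`. -/
def TaggedPartition.IsFine {a b : ℝ} (P : TaggedPartition a b) (δ : ℝ → ℝ) : Prop :=
  ∀ j < P.ν, Icc (P.pt j) (P.pt (j + 1)) ⊆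
    Ioo (P.tag j - δ (P.tag j)) (P.tag j + δ (P.tag j))

/-- The sum `∑ j, (U(τ_j, t_{j+1}) - U(τ_j, t_j))`. -/
def TaggedPartition.kurzweilSum {a b : ℝ} (P : TaggedPartition a b) (U : ℝ → ℝ → X) : X :=
  ∑ j ∈ Finset.range P.ν, (U (P.tag j) (P.pt (j + 1)) - U (P.tag j) (P.pt j))

/-- For `a ≤ b`: the Kurzweil integral `∫_a^b DU(τ, t)` exists and equals `I`. -/
def HasKurzweilIntegral (U : ℝ → ℝ → X) (a b : ℝ) (I : X) : Prop :=
  ∀ ε > 0, ∃ δ : ℝ → ℝ, (∀ τ ∈ Icc a b, 0 < δ τ) ∧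
    ∀ P : TaggedPartition a b, P.IsFine δ → ‖P.kurzweilSum U - I‖ < ε

/-- `U` is Kurzweil integrable on `[a, b]`. -/
def KurzweilIntegrable (U : ℝ → ℝ → X) (a b : ℝ) : Prop :=
  ∃ I, HasKurzweilIntegral U a b I

open Classical in
/-- The Kurzweil integral `∫_a^b DU(τ, t)` (with the value `0` where it does not exist). -/
noncomputable def kurzweilIntegral (U : ℝ → ℝ → X) (a b : ℝ) : X :=
  if H : KurzweilIntegrable U a b then H.choose else 0

variable [NormedSpace ℝ X]

/-- The Kurzweil-Stieltjes integral `∫_a^b g dh` of a vector function `g` with respect to a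
scalar function `h` exists. -/
def KSIntegrable (g : ℝ → X) (h : ℝ → ℝ) (a b : ℝ) : Prop :=
  KurzweilIntegrable (fun τ t => h t • g τ) a b

/-- The Kurzweil-Stieltjes integral `∫_a^b g dh`. For `h = id` this is the Henstock-Kurzweil
integral `∫_a^b g(s) ds`. -/
noncomputable def ksIntegral (g : ℝ → X) (h : ℝ → ℝ) (a b : ℝ) : X :=
  kurzweilIntegral (fun τ t => h t • g τ) a b

end Kurzweil

/-- `x` is regulated on `[0, T]`: all one-sided limits inside `[0, T]` exist. -/
def RegulatedOn {X : Type*} [TopologicalSpace X] (x : ℝ → X) (T : ℝ) : Prop :=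
  (∀ t ∈ Ioc 0 T, ∃ l, Tendsto x (𝓝[<] t) (𝓝 l)) ∧
  (∀ t ∈ Ico 0 T, ∃ l, Tendsto x (𝓝[>] t) (𝓝 l))

/-! ### Distributions -/

/-- Test functions: smooth functions `φ : ℝ → ℝⁿ` all of whose derivatives (including `φ`
itself) vanish outside `(0, T)`. -/
structure TestFun (n : ℕ) (T : ℝ) where
  toFun : ℝ → Rn n
  smooth : ContDiff ℝ ∞ toFun
  vanish : ∀ (j : ℕ) (t : ℝ), t ∉ Ioo 0 T → iteratedDeriv j toFun t = 0

/-- The derivative `φ'` of a test function. -/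
noncomputable def TestFun.derivative {n : ℕ} {T : ℝ} (φ : TestFun n T) : TestFun n T where
  toFun := deriv φ.toFun
  smooth := (contDiff_infty_iff_deriv.1 φ.smooth).2
  vanish := fun j t ht => by
    rw [← iteratedDeriv_succ']
    exact φ.vanish (j + 1) t ht

/-- The functional `⟨u, φ⟩ = ∫_0^T u(t) · φ(t) dt` given by a Lebesgue integrable function
`u : [0, T] → ℝⁿ`. -/
noncomputable def ofFun {n : ℕ} (T : ℝ) (u : ℝ → Rn n) : TestFun n T → ℝ :=
  fun φ => ∫ t in (0 : ℝ)..T, ∑ i, u t i * φ.toFun t i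

/-- The distributional derivative `⟨DL, φ⟩ = -⟨L, φ'⟩`. -/
noncomputable def distDeriv {n : ℕ} {T : ℝ} (L : TestFun n T → ℝ) : TestFun n T → ℝ :=
  fun φ => -L φ.derivative

/-- The product `g . Dh`, i.e. the distributional derivative of `t ↦ ∫_0^t g dh`; it has a
sense if `KSIntegrable g h 0 T`. -/
noncomputable def mulDeriv {n : ℕ} (T : ℝ) (g : ℝ → Rn n) (h : ℝ → ℝ) : TestFun n T → ℝ :=
  distDeriv (ofFun T fun t => ksIntegral g h 0 t)

/-! ### The two equations -/

/-- `(x, lam)` is a solution on `[0, T]` of the measure differential equation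
`Dx = f(lam, x, t) + g(x, t) . Dh`. -/
structure IsMDESolution {n : ℕ} (T : ℝ) (Λ : Set ℝ) (Ω : Set (Rn n))
    (f : ℝ → Rn n → ℝ → Rn n) (g : Rn n → ℝ → Rn n) (h : ℝ → ℝ)
    (x : ℝ → Rn n) (lam : ℝ) : Prop where
  param_mem : lam ∈ Λ
  boundedVariation : BoundedVariationOn x (Icc 0 T)
  leftContinuous : ∀ t ∈ Ioc 0 T, ContinuousWithinAt x (Iic t) t
  mem : ∀ t ∈ Icc 0 T, x t ∈ Ω
  /-- `t ↦ f(lam, x(t), t)` is a distribution on `[0, T]` -/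
  integrable : IntegrableOn (fun t => f lam (x t) t) (Icc 0 T)
  /-- the product `g(x, t) . Dh` has a sense -/
  product : KSIntegrable (fun t => g (x t) t) h 0 T
  equation : ∀ φ : TestFun n T,
    distDeriv (ofFun T x) φ =
      ofFun T (fun t => f lam (x t) t) φ + mulDeriv T (fun t => g (x t) t) h φ

/-- `(x, lam)` is a solution on `[0, T]` of the generalized ODE `dx/dτ = DF(lam, x, t)`:
`x(s) = x(0) + ∫_0^s DF(lam, x(τ), t)` for all `s`, the integral being required to exist. -/
structure IsGODESolution {n : ℕ} (T : ℝ) (Λ : Set ℝ) (Ω : Set (Rn n))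
    (F : ℝ → Rn n → ℝ → Rn n) (x : ℝ → Rn n) (lam : ℝ) : Prop where
  param_mem : lam ∈ Λ
  regulated : RegulatedOn x T
  mem : ∀ s ∈ Icc 0 T, x s ∈ Ω
  equation : ∀ s ∈ Icc 0 T,
    HasKurzweilIntegral (fun τ t => F lam (x τ) t) 0 s (x s - x 0)

/-- `F(lam, x, t) = ∫_0^t f(lam, x, s) ds + ∫_0^t g(x, s) dh(s)`. -/
noncomputable def rhs {n : ℕ} (f : ℝ → Rn n → ℝ → Rn n) (g : Rn n → ℝ → Rn n) (h : ℝ → ℝ) :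
    ℝ → Rn n → ℝ → Rn n :=
  fun lam x t => ksIntegral (fun s => f lam x s) id 0 t + ksIntegral (fun s => g x s) h 0 t

/-- The equation holds at the initial point `0`, which test functions do not see: the jump
there is `x(0+) - x(0) = (h(0+) - h(0)) g(x(0), 0)`. -/
def InitialJump {n : ℕ} (g : Rn n → ℝ → Rn n) (h : ℝ → ℝ) (x : ℝ → Rn n) : Prop :=
  Tendsto (fun t => x t - x 0 - (h t - h 0) • g (x 0) 0) (𝓝[>] 0) (𝓝 0)

end MDE

/-!
Put `Φ s = ∫_0^s f(λ, x(t), t) dt` and `Ψ s = ∫_0^s g(x(t), t) dh(t)`. Both problems are equivalent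
to the integral equation `x = x(0) + Φ + Ψ` on `[0, T]`.

For the generalized ODE this says that the Kurzweil integral of `F(λ, x(τ), t)` is `Φ + Ψ`. The
Riemann sums of a fine partition are exactly the integrals of `t ↦ f(λ, x(τ(t)), t)` and
`t ↦ g(x(τ(t)), t)`, where `τ(t)` is the tag of the cell `[c, d)` containing `t`; left-continuity
of `h` is what makes the endpoint `d` irrelevant. A regulated `x` has countably many
discontinuities, and there is a sequence of gauges forcing these to be their own tags eventually,
so that `x(τ(t)) → x(t)` for every `t` and dominated convergence applies.

For the measure differential equation, integration by parts gives `DΦ = f(λ, x, t)`, and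
`DΨ = g(x, t) . Dh` by definition, so the equation says `D(x - Φ - Ψ) = 0`. By the
du Bois-Reymond lemma and left-continuity, `x - Φ - Ψ` is constant on `(0, T]`; the jump
condition at `0` says that the constant is `x(0)`, since `Ψ(0+) = g(x(0), 0) (h(0+) - h(0))`.
-/

namespace MDE

/-! ### Fine partitions and the gauge integral -/

/-- An interval `[left, right]` with a tag. Unlike in `TaggedPartition`, the cells of a
`FinePartition` are nondegenerate and tagged at an endpoint: a cell `[s, t]` tagged at an inner
point `τ` contributes the same to a Kurzweil sum as `[s, τ]` and `[τ, t]` together. -/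
structure Cell where
  left : ℝ
  tag : ℝ
  right : ℝ

/-- The increment of `G` over a cell. -/
def Cell.diff {X : Type*} [Sub X] (p : Cell) (G : ℝ → X) : X := G p.right - G p.left

/-- `p` is a nondegenerate cell inside `[a, b]` that is tagged at one of its endpoints. -/
structure Cell.IsIn (p : Cell) (a b : ℝ) : Prop where
  le_left : a ≤ p.left
  left_lt_right : p.left < p.right
  right_le : p.right ≤ b
  tag_eq : p.tag = p.left ∨ p.tag = p.right

/-- `l` lists the cells of a `δ`-fine partition of `[a, b]` from left to right. -/
inductive FinePartition (δ : ℝ → ℝ) : ℝ → ℝ → List Cell → Prop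
  | nil (a : ℝ) : FinePartition δ a a []
  | cons {a b c τ : ℝ} {l : List Cell} : a < c → (τ = a ∨ τ = c) → c - a < δ τ →
      FinePartition δ c b l → FinePartition δ a b (⟨a, τ, c⟩ :: l)

/-- The filter of increasingly fine partitions of `[a, b]`. -/
def fineFilter (a b : ℝ) : Filter (List Cell) :=
  ⨅ δ : ℝ → Ioi (0 : ℝ), 𝓟 {l | FinePartition (fun t => δ t) a b l}

/-- The gauge integral over `[a, b]` of the function `φ` of tagged cells is `I`. -/
def HasGaugeIntegral {X : Type*} [AddCommMonoid X] [TopologicalSpace X] (φ : Cell → X)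
    (a b : ℝ) (I : X) : Prop :=
  Tendsto (fun l => (l.map φ).sum) (fineFilter a b) (𝓝 I)

namespace Cell.IsIn

variable {p : Cell} {a b s t : ℝ}

lemma left_mem (hp : p.IsIn a b) : p.left ∈ Icc a b :=
  ⟨hp.le_left, hp.left_lt_right.le.trans hp.right_le⟩

lemma right_mem (hp : p.IsIn a b) : p.right ∈ Icc a b :=
  ⟨hp.le_left.trans hp.left_lt_right.le, hp.right_le⟩

lemma tag_mem (hp : p.IsIn a b) : p.tag ∈ Icc a b := by
  rcases hp.tag_eq with h | h <;> rw [h]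
  exacts [hp.left_mem, hp.right_mem]

lemma mono (hp : p.IsIn s t) (ha : a ≤ s) (hb : t ≤ b) : p.IsIn a b :=
  ⟨ha.trans hp.le_left, hp.left_lt_right, hp.right_le.trans hb, hp.tag_eq⟩

lemma diff_nonneg {V : ℝ → ℝ} (hp : p.IsIn a b) (hV : MonotoneOn V (Icc a b)) : 0 ≤ p.diff V :=
  sub_nonneg.2 (hV hp.left_mem hp.right_mem hp.left_lt_right.le)

end Cell.IsIn

lemma abs_sum_map_le (φ : Cell → ℝ) (l : List Cell) :
    |(l.map φ).sum| ≤ (l.map fun p => |φ p|).sum := by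
  simpa only [List.map_map, Function.comp_def] using
    List.le_sum_of_subadditive (fun x : ℝ => |x|) abs_zero.le abs_add_le (l.map φ)

namespace FinePartition

variable {δ δ' : ℝ → ℝ} {a b c : ℝ} {l l' : List Cell} {p : Cell}

lemma le (H : FinePartition δ a b l) : a ≤ b := by
  induction H with
  | nil => exact le_rfl
  | cons hac _ _ _ ih => exact hac.le.trans ih

lemma isIn (H : FinePartition δ a b l) (hp : p ∈ l) : p.IsIn a b := by
  induction H with
  | nil => simp at hp
  | cons hac hτ _ hl ih =>
    rcases List.mem_cons.1 hp with rfl | hp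
    exacts [⟨le_rfl, hac, hl.le, hτ⟩, (ih hp).mono hac.le le_rfl]

lemma right_sub_left_lt (H : FinePartition δ a b l) (hp : p ∈ l) :
    p.right - p.left < δ p.tag := by
  induction H with
  | nil => simp at hp
  | cons _ _ hδ _ ih =>
    rcases List.mem_cons.1 hp with rfl | hp
    exacts [hδ, ih hp]

lemma mono (H : FinePartition δ a b l) (hδ : ∀ t ∈ Icc a b, δ t ≤ δ' t) :
    FinePartition δ' a b l := by
  induction H with
  | nil a => exact .nil a
  | @cons a b c τ l hac hτ hfine hl ih =>
    have hτ_mem : τ ∈ Icc a b := Cell.IsIn.tag_mem (p := ⟨a, τ, c⟩) ⟨le_rfl, hac, hl.le, hτ⟩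
    exact .cons hac hτ (hfine.trans_le (hδ _ hτ_mem))
      (ih fun t ht => hδ t ⟨hac.le.trans ht.1, ht.2⟩)

lemma append (H : FinePartition δ a b l) (H' : FinePartition δ b c l') :
    FinePartition δ a c (l ++ l') := by
  induction H with
  | nil => exact H'
  | cons hac hτ hfine _ ih => exact .cons hac hτ hfine (ih H')

lemma exists_append_of_gauge_le (H : FinePartition δ a c l) (hab : a ≤ b) (hbc : b ≤ c)
    (hδ : ∀ t, t ≠ b → δ t ≤ |t - b|) :
    ∃ l₁ l₂, l = l₁ ++ l₂ ∧ FinePartition δ a b l₁ ∧ FinePartition δ b c l₂ := by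
  induction H with
  | nil a =>
    obtain rfl : a = b := le_antisymm hab hbc
    exact ⟨[], [], rfl, .nil _, .nil _⟩
  | @cons a c d τ l had hτ hfine hl ih =>
    rcases hab.eq_or_lt with rfl | hab
    · exact ⟨[], _, rfl, .nil _, .cons had hτ hfine hl⟩
    rcases le_or_gt d b with hd | hd
    · obtain ⟨l₁, l₂, rfl, h₁, h₂⟩ := ih hd hbc
      exact ⟨_, l₂, rfl, .cons had hτ hfine h₁, h₂⟩
    · -- A cell with `b` in its interior would be tagged at an endpoint too close to `b`.
      have hτb : τ ≠ b := by rintro rfl; rcases hτ with rfl | rfl <;> exact lt_irrefl _ ‹_›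
      have hle : |τ - b| ≤ d - a := by
        rcases hτ with rfl | rfl <;> rw [abs_le] <;> constructor <;> linarith
      exact absurd (hδ τ hτb) (by linarith)

lemma sum_map_diff {X : Type*} [AddCommGroup X] (G : ℝ → X) (H : FinePartition δ a b l) :
    (l.map fun p => p.diff G).sum = G b - G a := by
  induction H with
  | nil => simp
  | cons _ _ _ _ ih => rw [List.map_cons, List.sum_cons, ih, Cell.diff, sub_add_sub_cancel']

lemma sum_map_congr {X : Type*} [AddCommMonoid X] {φ ψ : Cell → X} (H : FinePartition δ a b l)
    (h : ∀ p : Cell, p.IsIn a b → φ p = ψ p) : (l.map φ).sum = (l.map ψ).sum := by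
  rw [List.map_congr_left fun p hp => h p (H.isIn hp)]

lemma sum_map_le_sum_map {φ ψ : Cell → ℝ} (H : FinePartition δ a b l)
    (h : ∀ p : Cell, p.IsIn a b → φ p ≤ ψ p) : (l.map φ).sum ≤ (l.map ψ).sum :=
  List.sum_le_sum fun p hp => h p (H.isIn hp)

lemma sum_map_nonneg {φ : Cell → ℝ} (H : FinePartition δ a b l)
    (h : ∀ p : Cell, p.IsIn a b → 0 ≤ φ p) : 0 ≤ (l.map φ).sum := by
  simpa using H.sum_map_le_sum_map h

end FinePartition

/-- **Cousin's lemma**. -/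
lemma exists_finePartition {δ : ℝ → ℝ} (hδ : ∀ t, 0 < δ t) {a b : ℝ} (hab : a ≤ b) :
    ∃ l, FinePartition δ a b l := by
  set S := {t | t ∈ Icc a b ∧ ∃ l, FinePartition δ a t l}
  have haS : a ∈ S := ⟨left_mem_Icc.2 hab, [], .nil a⟩
  have hS_bdd : BddAbove S := ⟨b, fun t ht => ht.1.2⟩
  set z := sSup S
  have haz : a ≤ z := le_csSup hS_bdd haS
  have hzb : z ≤ b := csSup_le ⟨a, haS⟩ fun t ht => ht.1.2
  obtain ⟨lz, hlz⟩ : ∃ l, FinePartition δ a z l := by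
    obtain ⟨s, hs, hzs⟩ := exists_lt_of_lt_csSup ⟨a, haS⟩ (sub_lt_self z (hδ z))
    obtain ⟨l, hl⟩ := hs.2
    rcases (le_csSup hS_bdd hs).eq_or_lt with h_eq | h_lt
    · exact ⟨l, by rwa [show z = s from h_eq.symm]⟩
    · exact ⟨_, hl.append (.cons h_lt (.inr rfl) (by linarith) (.nil z))⟩
  rcases hzb.eq_or_lt with h_eq | h_lt
  · exact ⟨lz, h_eq ▸ hlz⟩
  obtain ⟨c, hzc, hc⟩ := exists_between (lt_min h_lt (lt_add_of_pos_right z (hδ z)))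
  obtain ⟨hcb, hcδ⟩ := lt_min_iff.1 hc
  have hcS : c ∈ S := ⟨⟨haz.trans hzc.le, hcb.le⟩, _,
    hlz.append (.cons hzc (.inl rfl) (by linarith) (.nil c))⟩
  exact absurd (le_csSup hS_bdd hcS) (not_le.2 hzc)

section FineFilter

variable {a b c : ℝ}

lemma eventually_fineFilter {P : List Cell → Prop} :
    (∀ᶠ l in fineFilter a b, P l) ↔
      ∃ δ : ℝ → ℝ, (∀ t, 0 < δ t) ∧ ∀ l, FinePartition δ a b l → P l := by
  have h_basis : (fineFilter a b).HasBasis (fun _ => True)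
      fun δ : ℝ → Ioi (0 : ℝ) => {l | FinePartition (fun t => δ t) a b l} :=
    hasBasis_iInf_principal fun δ₁ δ₂ =>
      ⟨fun t => ⟨min (δ₁ t) (δ₂ t), mem_Ioi.2 (lt_min (δ₁ t).2 (δ₂ t).2)⟩,
        fun _ hl => FinePartition.mono hl fun _ _ => min_le_left _ _,
        fun _ hl => FinePartition.mono hl fun _ _ => min_le_right _ _⟩
  rw [h_basis.eventually_iff]
  constructor
  · rintro ⟨δ, -, H⟩
    exact ⟨fun t => δ t, fun t => (δ t).2, fun l hl => H hl⟩
  · rintro ⟨δ, hδ, H⟩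
    exact ⟨fun t => ⟨δ t, hδ t⟩, trivial, fun l hl => H l hl⟩

lemma eventually_finePartition {δ : ℝ → ℝ} (hδ : ∀ t, 0 < δ t) (a b : ℝ) :
    ∀ᶠ l in fineFilter a b, FinePartition δ a b l :=
  eventually_fineFilter.2 ⟨δ, hδ, fun _ h => h⟩

lemma eventually_finePartition_one (a b : ℝ) :
    ∀ᶠ l in fineFilter a b, FinePartition (fun _ => 1) a b l :=
  eventually_finePartition (fun _ => one_pos) a b

lemma fineFilter_neBot (hab : a ≤ b) : (fineFilter a b).NeBot := by
  rw [neBot_iff, ne_eq, ← eventually_false_iff_eq_bot, eventually_fineFilter]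
  rintro ⟨δ, hδ, H⟩
  obtain ⟨l, hl⟩ := exists_finePartition hδ hab
  exact H l hl

lemma fineFilter_self (a : ℝ) : fineFilter a a = pure [] := by
  refine le_antisymm (le_pure_iff.2 ?_) fun s hs => ?_
  · filter_upwards [eventually_finePartition_one a a] with l hl
    cases hl with
    | nil => rfl
    | cons hac _ _ hl => exact absurd hl.le (not_le.2 hac)
  · obtain ⟨δ, -, H⟩ := eventually_fineFilter.1 hs
    exact H [] (.nil a)

lemma fineFilter_le_map_append (hab : a ≤ b) (hbc : b ≤ c) :
    fineFilter a c ≤ map (fun q => q.1 ++ q.2) (fineFilter a b ×ˢ fineFilter b c) := by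
  intro s hs
  obtain ⟨P, hP, Q, hQ, hPQ⟩ := eventually_prod_iff.1 (mem_map.1 hs)
  obtain ⟨δ₁, hδ₁, H₁⟩ := eventually_fineFilter.1 hP
  obtain ⟨δ₂, hδ₂, H₂⟩ := eventually_fineFilter.1 hQ
  refine eventually_fineFilter.2
    ⟨fun t => min (min (δ₁ t) (δ₂ t)) (if t = b then 1 else |t - b|), fun t => ?_, fun l hl => ?_⟩
  · refine lt_min (lt_min (hδ₁ t) (hδ₂ t)) ?_
    split_ifs with ht
    exacts [one_pos, abs_pos.2 (sub_ne_zero.2 ht)]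
  · obtain ⟨l₁, l₂, rfl, h₁, h₂⟩ := hl.exists_append_of_gauge_le hab hbc fun t ht => by
      simp only [if_neg ht, min_le_right]
    exact hPQ (H₁ _ (h₁.mono fun t _ => (min_le_left _ _).trans (min_le_left _ _)))
      (H₂ _ (h₂.mono fun t _ => (min_le_left _ _).trans (min_le_right _ _)))

end FineFilter

namespace HasGaugeIntegral

section Topological

variable {X : Type*} [TopologicalSpace X] {a b c : ℝ}

lemma unique [AddCommMonoid X] [T2Space X] {φ : Cell → X} {I J : X} (hab : a ≤ b)
    (H : HasGaugeIntegral φ a b I) (H' : HasGaugeIntegral φ a b J) : I = J :=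
  have := fineFilter_neBot hab
  tendsto_nhds_unique H H'

lemma congr [AddCommMonoid X] {φ ψ : Cell → X} {I : X} (H : HasGaugeIntegral φ a b I)
    (h : ∀ p : Cell, p.IsIn a b → φ p = ψ p) : HasGaugeIntegral ψ a b I := by
  refine Tendsto.congr' ?_ H
  filter_upwards [eventually_finePartition_one a b] with l hl using hl.sum_map_congr h

lemma self [AddCommMonoid X] (φ : Cell → X) (a : ℝ) : HasGaugeIntegral φ a a 0 := by
  rw [HasGaugeIntegral, fineFilter_self]
  exact tendsto_pure_nhds _ _

lemma add [AddCommMonoid X] [ContinuousAdd X] {φ ψ : Cell → X} {I J : X}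
    (H : HasGaugeIntegral φ a b I) (H' : HasGaugeIntegral ψ a b J) :
    HasGaugeIntegral (fun p => φ p + ψ p) a b (I + J) :=
  (Tendsto.add H H').congr fun _ => List.sum_map_add.symm

lemma trans [AddCommMonoid X] [ContinuousAdd X] {φ : Cell → X} {I J : X} (hab : a ≤ b)
    (hbc : b ≤ c) (H : HasGaugeIntegral φ a b I) (H' : HasGaugeIntegral φ b c J) :
    HasGaugeIntegral φ a c (I + J) := by
  refine Tendsto.mono_left (tendsto_map'_iff.2 ?_) (fineFilter_le_map_append hab hbc)
  refine ((H.comp tendsto_fst).add (H'.comp tendsto_snd)).congr fun q => ?_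
  simp only [Function.comp_apply, List.map_append, List.sum_append]

lemma diff [AddCommGroup X] (G : ℝ → X) (a b : ℝ) :
    HasGaugeIntegral (fun p => p.diff G) a b (G b - G a) := by
  refine tendsto_nhds_of_eventually_eq ?_
  filter_upwards [eventually_finePartition_one a b] with l hl using hl.sum_map_diff G

end Topological

section Indefinite

variable {X : Type*} [NormedAddCommGroup X] [CompleteSpace X] {φ : Cell → X} {a b s t : ℝ} {I : X}

lemma exists_subinterval (H : HasGaugeIntegral φ a b I) (has : a ≤ s) (hst : s ≤ t)
    (htb : t ≤ b) : ∃ K, HasGaugeIntegral φ s t K := by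
  have := fineFilter_neBot hst
  refine cauchy_map_iff_exists_tendsto.1 (cauchy_map_iff.2 ⟨inferInstance, ?_⟩)
  rw [Metric.uniformity_basis_dist.tendsto_right_iff]
  intro ε hε
  obtain ⟨δ, hδ, Hδ⟩ := eventually_fineFilter.1 (Metric.tendsto_nhds.1 H (ε / 2) (half_pos hε))
  obtain ⟨l₁, h₁⟩ := exists_finePartition hδ has
  obtain ⟨l₂, h₂⟩ := exists_finePartition hδ htb
  have h_fine := eventually_finePartition hδ s t
  filter_upwards [h_fine.prod_mk h_fine] with ⟨l, l'⟩ ⟨hl, hl'⟩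
  have h_dist := dist_triangle_right _ _ I |>.trans_lt
    (add_lt_add (Hδ _ ((h₁.append hl).append h₂)) (Hδ _ ((h₁.append hl').append h₂)))
  simpa only [List.map_append, List.sum_append, dist_add_right, dist_add_left, add_halves]
    using h_dist

lemma exists_indefinite (hab : a ≤ b) (H : HasGaugeIntegral φ a b I) :
    ∃ G : ℝ → X, G a = 0 ∧
      ∀ s t, a ≤ s → s ≤ t → t ≤ b → HasGaugeIntegral φ s t (G t - G s) := by
  choose! G hG using fun t (ht : t ∈ Icc a b) => H.exists_subinterval le_rfl ht.1 ht.2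
  refine ⟨G, (hG a (left_mem_Icc.2 hab)).unique le_rfl (self φ a), fun s t has hst htb => ?_⟩
  obtain ⟨K, hK⟩ := H.exists_subinterval has hst htb
  have h_add : G s + K = G t := ((hG s ⟨has, hst.trans htb⟩).trans has hst hK).unique
    (has.trans hst) (hG t ⟨has.trans hst, htb⟩)
  rwa [← h_add, add_sub_cancel_left]

end Indefinite

section Real

variable {φ ψ : Cell → ℝ} {a b I J : ℝ}

lemma const_mul (r : ℝ) (H : HasGaugeIntegral φ a b I) :
    HasGaugeIntegral (fun p => r * φ p) a b (r * I) :=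
  (Tendsto.const_mul r H).congr fun _ => (List.sum_map_mul_left ..).symm

lemma neg (H : HasGaugeIntegral φ a b I) : HasGaugeIntegral (fun p => -φ p) a b (-I) := by
  simpa only [neg_one_mul] using H.const_mul (-1)

lemma sub (H : HasGaugeIntegral φ a b I) (H' : HasGaugeIntegral ψ a b J) :
    HasGaugeIntegral (fun p => φ p - ψ p) a b (I - J) := by
  simpa only [sub_eq_add_neg] using H.add H'.neg

lemma le (hab : a ≤ b) (H : HasGaugeIntegral φ a b I) (H' : HasGaugeIntegral ψ a b J)
    (h : ∀ p : Cell, p.IsIn a b → φ p ≤ ψ p) : I ≤ J := by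
  have := fineFilter_neBot hab
  refine le_of_tendsto_of_tendsto H H' ?_
  filter_upwards [eventually_finePartition_one a b] with l hl using hl.sum_map_le_sum_map h

end Real

end HasGaugeIntegral

/-! ### The Saks–Henstock lemma and gluing of gauges -/

namespace HasGaugeIntegral

variable {φ ψ : Cell → ℝ} {a b I : ℝ}

lemma zero_of_nonneg (hφ : ∀ p : Cell, p.IsIn a b → 0 ≤ φ p)
    (H : ∀ ε > 0, ∀ᶠ l in fineFilter a b, (l.map φ).sum ≤ ε) : HasGaugeIntegral φ a b 0 := by
  refine Metric.tendsto_nhds.2 fun ε hε => ?_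
  filter_upwards [H (ε / 2) (half_pos hε), eventually_finePartition_one a b] with l h_le hl
  rw [dist_zero_right, Real.norm_of_nonneg (hl.sum_map_nonneg hφ)]
  exact h_le.trans_lt (half_lt_self hε)

lemma zero_of_abs_le (hφψ : ∀ p : Cell, p.IsIn a b → |φ p| ≤ ψ p)
    (H : HasGaugeIntegral ψ a b 0) : HasGaugeIntegral φ a b 0 := by
  refine squeeze_zero_norm' ?_ H
  filter_upwards [eventually_finePartition_one a b] with l hl
  exact (abs_sum_map_le φ l).trans (hl.sum_map_le_sum_map hφψ)

lemma eventually_le (H : HasGaugeIntegral φ a b I) {ε : ℝ} (hε : 0 < ε) :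
    ∀ᶠ l in fineFilter a b, (l.map φ).sum ≤ I + ε :=
  (H.eventually (gt_mem_nhds (lt_add_of_pos_right I hε))).mono fun _ => le_of_lt

end HasGaugeIntegral

section SaksHenstock

variable {φ ψ : Cell → ℝ} {a b : ℝ}

lemma FinePartition.exists_sum_posPart_le {δ : ℝ → ℝ} (hδ : ∀ t, 0 < δ t) {l : List Cell}
    (H : FinePartition δ a b l)
    (hψ : ∀ s t, a ≤ s → s ≤ t → t ≤ b → HasGaugeIntegral ψ s t 0) {η : ℝ} (hη : 0 < η) :
    ∃ l', FinePartition δ a b l' ∧ (l.map fun p => max (ψ p) 0).sum ≤ (l'.map ψ).sum + η := by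
  induction H generalizing η with
  | nil a => exact ⟨[], .nil a, by simpa using hη.le⟩
  | @cons a b c τ l hac hτ hfine hl ih =>
    obtain ⟨l', hl', h_le⟩ := ih (fun s t hs => hψ s t (hac.le.trans hs)) (half_pos hη)
    rcases le_total 0 (ψ ⟨a, τ, c⟩) with h_nonneg | h_nonpos
    · refine ⟨_, .cons hac hτ hfine hl', ?_⟩
      simp only [List.map_cons, List.sum_cons, max_eq_left h_nonneg]
      linarith
    · -- A cell with a negative contribution is subdivided until it contributes almost nothing.
      have := fineFilter_neBot hac.le
      obtain ⟨l₀, h₀, hl₀⟩ := (((hψ a c le_rfl hac.le hl.le).eventually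
        (lt_mem_nhds (neg_neg_of_pos (half_pos hη)))).and (eventually_finePartition hδ a c)).exists
      refine ⟨_, hl₀.append hl', ?_⟩
      simp only [List.map_cons, List.sum_cons, max_eq_right h_nonpos, List.map_append,
        List.sum_append]
      linarith

lemma hasGaugeIntegral_posPart_zero
    (hψ : ∀ s t, a ≤ s → s ≤ t → t ≤ b → HasGaugeIntegral ψ s t 0) (hab : a ≤ b) :
    HasGaugeIntegral (fun p => max (ψ p) 0) a b 0 := by
  refine .zero_of_nonneg (fun _ _ => le_max_right _ _) fun ε hε => ?_
  obtain ⟨δ, hδ, H⟩ := eventually_fineFilter.1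
    ((hψ a b le_rfl hab le_rfl).eventually_le (half_pos hε))
  refine eventually_fineFilter.2 ⟨δ, hδ, fun l hl => ?_⟩
  obtain ⟨l', hl', h_le⟩ := hl.exists_sum_posPart_le hδ hψ (half_pos hε)
  linarith [H l' hl']

lemma saks_henstock {G : ℝ → ℝ}
    (hφ : ∀ s t, a ≤ s → s ≤ t → t ≤ b → HasGaugeIntegral φ s t (G t - G s)) (hab : a ≤ b) :
    HasGaugeIntegral (fun p => |φ p - p.diff G|) a b 0 := by
  have h_sub : ∀ s t, a ≤ s → s ≤ t → t ≤ b →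
      HasGaugeIntegral (fun p => φ p - p.diff G) s t 0 := fun s t has hst htb => by
    simpa only [sub_self] using (hφ s t has hst htb).sub (.diff G s t)
  have h_neg : ∀ s t, a ≤ s → s ≤ t → t ≤ b →
      HasGaugeIntegral (fun p => -(φ p - p.diff G)) s t 0 := fun s t has hst htb => by
    simpa only [neg_zero] using (h_sub s t has hst htb).neg
  simpa only [max_zero_add_max_neg_zero_eq_abs_self, add_zero] using
    (hasGaugeIntegral_posPart_zero h_sub hab).add (hasGaugeIntegral_posPart_zero h_neg hab)

end SaksHenstock

section Gluing

variable {a b : ℝ}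

lemma FinePartition.exists_sum_ite_le {δ δ' : ℝ → ℝ} (hδ' : ∀ t, 0 < δ' t) {ψ : Cell → ℝ}
    {q : Cell → Prop} [DecidablePred q] {l : List Cell} (H : FinePartition δ a b l)
    (hψ : ∀ p : Cell, p.IsIn a b → 0 ≤ ψ p)
    (hq : ∀ p ∈ l, q p → δ p.tag ≤ δ' p.tag) :
    ∃ l', FinePartition δ' a b l' ∧
      (l.map fun p => if q p then ψ p else 0).sum ≤ (l'.map ψ).sum := by
  induction H with
  | nil a => exact ⟨[], .nil a, by simp⟩
  | @cons a b c τ l hac hτ hfine hl ih =>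
    obtain ⟨l', hl', h_le⟩ := ih (fun p hp => hψ p (hp.mono hac.le le_rfl))
      fun p hp => hq p (List.mem_cons_of_mem _ hp)
    rw [List.map_cons, List.sum_cons]
    split_ifs with hqp
    · refine ⟨_, .cons hac hτ (hfine.trans_le (hq _ List.mem_cons_self hqp)) hl', ?_⟩
      rw [List.map_cons, List.sum_cons]
      linarith
    · obtain ⟨l₀, hl₀⟩ := exists_finePartition hδ' hac.le
      refine ⟨_, hl₀.append hl', ?_⟩
      rw [List.map_append, List.sum_append]
      linarith [hl₀.sum_map_nonneg fun p hp => hψ p (hp.mono le_rfl hl.le)]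

lemma sum_map_sum_range_eq (ψ : ℕ → Cell → ℝ) (N : ℝ → ℕ) {n : ℕ} (l : List Cell)
    (hn : ∀ p ∈ l, N p.tag ≤ n) :
    (l.map fun p => ∑ k ∈ Finset.range (N p.tag), ψ k p).sum =
      ∑ k ∈ Finset.range n, (l.map fun p => if k < N p.tag then ψ k p else 0).sum := by
  induction l with
  | nil => simp
  | cons p l ih =>
    have h_filter : (Finset.range n).filter (· < N p.tag) = Finset.range (N p.tag) := by
      ext k
      have := hn p List.mem_cons_self
      simp only [Finset.mem_filter, Finset.mem_range]
      omega
    simp only [List.map_cons, List.sum_cons, Finset.sum_add_distrib, ← Finset.sum_filter, h_filter]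
    rw [ih fun q hq => hn q (List.mem_cons_of_mem _ hq)]

lemma eventually_sum_sum_range_le {ψ : ℕ → Cell → ℝ} {J : ℕ → ℝ} {C : ℝ}
    (hψ_nonneg : ∀ k, ∀ p : Cell, p.IsIn a b → 0 ≤ ψ k p)
    (hψ : ∀ k, HasGaugeIntegral (ψ k) a b (J k)) (hJ : ∀ n, ∑ k ∈ Finset.range n, J k ≤ C)
    (N : ℝ → ℕ) {ε : ℝ} (hε : 0 < ε) :
    ∀ᶠ l in fineFilter a b,
      (l.map fun p => ∑ k ∈ Finset.range (N p.tag), ψ k p).sum ≤ C + ε := by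
  choose δ hδ H using fun k : ℕ => eventually_fineFilter.1
    ((hψ k).eventually_le (show 0 < ε / 2 * (1 / 2) ^ k by positivity))
  -- At the tag `t`, only the first `N t` gauges matter.
  refine eventually_fineFilter.2 ⟨fun t => (Finset.range (N t + 1)).inf'
    Finset.nonempty_range_add_one (δ · t), fun t => ?_, fun l hl => ?_⟩
  · exact (Finset.lt_inf'_iff _).2 fun k _ => hδ k t
  have h_le : ∀ k, (l.map fun p => if k < N p.tag then ψ k p else 0).sum ≤
      J k + ε / 2 * (1 / 2) ^ k := fun k => by
    obtain ⟨l', hl', h⟩ := hl.exists_sum_ite_le (hδ k) (hψ_nonneg k) fun p _ hk =>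
      Finset.inf'_le (δ · p.tag) (Finset.mem_range.2 (Nat.lt_succ_of_lt hk))
    exact h.trans (H k l' hl')
  obtain ⟨n, hn⟩ : ∃ n, ∀ p ∈ l, N p.tag ≤ n :=
    ⟨(l.map fun p => N p.tag).sum, fun p hp => List.le_sum_of_mem (List.mem_map_of_mem hp)⟩
  rw [sum_map_sum_range_eq ψ N l hn]
  calc _ ≤ ∑ k ∈ Finset.range n, (J k + ε / 2 * (1 / 2) ^ k) := Finset.sum_le_sum fun k _ => h_le k
    _ = ∑ k ∈ Finset.range n, J k + ε / 2 * ∑ k ∈ Finset.range n, (1 / 2 : ℝ) ^ k := by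
      rw [Finset.sum_add_distrib, Finset.mul_sum]
    _ ≤ C + ε / 2 * 2 := by gcongr; exacts [hJ n, sum_geometric_two_le n]
    _ = C + ε := by ring

lemma HasGaugeIntegral.mul_abs_tag {ψ : Cell → ℝ} (hψ_nonneg : ∀ p : Cell, p.IsIn a b → 0 ≤ ψ p)
    (hψ : HasGaugeIntegral ψ a b 0) (u : ℝ → ℝ) :
    HasGaugeIntegral (fun p => |u p.tag| * ψ p) a b 0 := by
  refine .zero_of_nonneg (fun p hp => mul_nonneg (abs_nonneg _) (hψ_nonneg p hp)) fun ε hε => ?_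
  filter_upwards [eventually_finePartition_one a b, eventually_sum_sum_range_le (C := 0)
    (fun _ => hψ_nonneg) (fun _ => hψ) (by simp) (fun t => ⌈|u t|⌉₊) hε] with l hl h_le
  rw [zero_add] at h_le
  refine (hl.sum_map_le_sum_map fun p hp => ?_).trans h_le
  rw [Finset.sum_const, Finset.card_range, nsmul_eq_mul]
  exact mul_le_mul_of_nonneg_right (Nat.le_ceil _) (hψ_nonneg p hp)

end Gluing

/-! ### Variation -/

lemma boundedVariationOn_of_dist_le {X : Type*} [PseudoMetricSpace X] {G : ℝ → X} {M : ℝ → ℝ}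
    {a b : ℝ} (H : ∀ s t, a ≤ s → s ≤ t → t ≤ b → dist (G s) (G t) ≤ M t - M s) :
    BoundedVariationOn G (Icc a b) := by
  have hM : MonotoneOn M (Icc a b) := fun s hs t ht hst =>
    sub_nonneg.1 (dist_nonneg.trans (H s t hs.1 hst ht.2))
  refine ne_top_of_le_ne_top (ENNReal.ofReal_ne_top (r := M b - M a)) (iSup_le ?_)
  rintro ⟨n, u, hu, hus⟩
  calc ∑ i ∈ Finset.range n, edist (G (u (i + 1))) (G (u i))
      ≤ ∑ i ∈ Finset.range n, ENNReal.ofReal (M (u (i + 1)) - M (u i)) := by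
        refine Finset.sum_le_sum fun i _ => ?_
        rw [edist_dist, dist_comm]
        exact ENNReal.ofReal_le_ofReal (H _ _ (hus i).1 (hu i.le_succ) (hus (i + 1)).2)
    _ = ENNReal.ofReal (M (u n) - M (u 0)) := by
        rw [← ENNReal.ofReal_sum_of_nonneg fun i _ =>
          sub_nonneg.2 (hM (hus i) (hus (i + 1)) (hu i.le_succ)),
          Finset.sum_range_sub fun i => M (u i)]
    _ ≤ ENNReal.ofReal (M b - M a) := by
        have hab : a ≤ b := (hus 0).1.trans (hus 0).2
        gcongr
        exacts [hM (hus n) (right_mem_Icc.2 hab) (hus n).2,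
          hM (left_mem_Icc.2 hab) (hus 0) (hus 0).1]

section AbsDiff

variable {G : ℝ → ℝ} {a b : ℝ}

lemma FinePartition.ofReal_sum_abs_diff_le {δ : ℝ → ℝ} {l : List Cell}
    (H : FinePartition δ a b l) :
    ENNReal.ofReal (l.map fun p => |p.diff G|).sum ≤ eVariationOn G (Icc a b) := by
  induction H with
  | nil a => simp
  | cons hac _ _ hl ih =>
    have h_split := eVariationOn.Icc_add_Icc G hac.le hl.le (mem_univ _)
    simp only [univ_inter] at h_split
    rw [List.map_cons, List.sum_cons, ENNReal.ofReal_add (abs_nonneg _)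
      (hl.sum_map_nonneg fun _ _ => abs_nonneg _), ← h_split]
    refine add_le_add ?_ ih
    rw [Cell.diff, ← Real.dist_eq, ← edist_dist]
    exact eVariationOn.edist_le G (right_mem_Icc.2 hac.le) (left_mem_Icc.2 hac.le)

lemma eventually_sum_le_sum_abs_diff {u : ℕ → ℝ} (hu : Monotone u) (ha : a ≤ u 0) (n : ℕ) :
    ∀ᶠ l in fineFilter a (u n),
      ∑ i ∈ Finset.range n, |G (u (i + 1)) - G (u i)| ≤ (l.map fun p => |p.diff G|).sum := by
  induction n with
  | zero =>
    filter_upwards [eventually_finePartition_one a (u 0)] with l hl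
    simpa using hl.sum_map_nonneg (φ := fun p => |p.diff G|) fun _ _ => abs_nonneg _
  | succ n ih =>
    refine fineFilter_le_map_append (ha.trans (hu n.zero_le)) (hu n.le_succ) (mem_map.2 ?_)
    filter_upwards [ih.prod_mk (eventually_finePartition_one (u n) (u (n + 1)))]
      with ⟨l₁, l₂⟩ ⟨h₁, h₂⟩
    change _ ≤ ((l₁ ++ l₂).map fun p => |p.diff G|).sum
    rw [Finset.sum_range_succ, List.map_append, List.sum_append,
      ← h₂.sum_map_diff G]
    exact add_le_add h₁ (abs_sum_map_le _ _)

lemma hasGaugeIntegral_abs_diff (H : BoundedVariationOn G (Icc a b)) :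
    HasGaugeIntegral (fun p => |p.diff G|) a b (eVariationOn G (Icc a b)).toReal := by
  refine tendsto_order.2 ⟨fun r hr => ?_, fun r hr => ?_⟩
  · rcases lt_or_ge r 0 with hr0 | hr0
    · filter_upwards [eventually_finePartition_one a b] with l hl
      exact hr0.trans_le (hl.sum_map_nonneg fun _ _ => abs_nonneg _)
    obtain ⟨⟨n, u, hu, hus⟩, hn⟩ := lt_iSup_iff.1 ((ENNReal.ofReal_lt_iff_lt_toReal hr0 H).2 hr)
    have hr_lt : r < ∑ i ∈ Finset.range n, |G (u (i + 1)) - G (u i)| := by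
      simp only [edist_dist, Real.dist_eq] at hn
      rw [← ENNReal.ofReal_sum_of_nonneg fun _ _ => abs_nonneg _] at hn
      exact (ENNReal.ofReal_lt_ofReal_iff_of_nonneg hr0).1 hn
    refine fineFilter_le_map_append (hus n).1 (hus n).2 (mem_map.2 ?_)
    filter_upwards [(eventually_sum_le_sum_abs_diff (G := G) hu (hus 0).1 n).prod_mk
      (eventually_finePartition_one (u n) b)] with ⟨l₁, l₂⟩ ⟨h₁, h₂⟩
    change r < ((l₁ ++ l₂).map fun p => |p.diff G|).sum
    rw [List.map_append, List.sum_append]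
    have h_nonneg := h₂.sum_map_nonneg (φ := fun p => |p.diff G|) fun _ _ => abs_nonneg _
    linarith
  · filter_upwards [eventually_finePartition_one a b] with l hl
    refine lt_of_le_of_lt ?_ hr
    rw [← ENNReal.ofReal_le_iff_le_toReal H]
    exact hl.ofReal_sum_abs_diff_le

end AbsDiff

/-- On `[a, b]`, the function `V` is `t ↦ var_a^t h` up to a constant. -/
structure IsVariationOn (h V : ℝ → ℝ) (a b : ℝ) : Prop where
  monotoneOn : MonotoneOn V (Icc a b)
  eVariationOn_eq : ∀ s t, a ≤ s → s ≤ t → t ≤ b →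
    eVariationOn h (Icc s t) = ENNReal.ofReal (V t - V s)

namespace IsVariationOn

variable {h V : ℝ → ℝ} {a b : ℝ}

lemma abs_sub_le (hV : IsVariationOn h V a b) {s t : ℝ} (has : a ≤ s) (hst : s ≤ t)
    (htb : t ≤ b) : |h t - h s| ≤ V t - V s := by
  have h_mono := hV.monotoneOn ⟨has, hst.trans htb⟩ ⟨has.trans hst, htb⟩ hst
  rw [← ENNReal.ofReal_le_ofReal_iff (sub_nonneg.2 h_mono), ← hV.eVariationOn_eq s t has hst htb,
    ← Real.dist_eq, ← edist_dist]
  exact eVariationOn.edist_le h (right_mem_Icc.2 hst) (left_mem_Icc.2 hst)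

lemma abs_diff_le (hV : IsVariationOn h V a b) {p : Cell} (hp : p.IsIn a b) :
    |p.diff h| ≤ p.diff V :=
  hV.abs_sub_le hp.le_left hp.left_lt_right.le hp.right_le

lemma mono (hV : IsVariationOn h V a b) {s t : ℝ} (has : a ≤ s) (htb : t ≤ b) :
    IsVariationOn h V s t where
  monotoneOn := hV.monotoneOn.mono (Icc_subset_Icc has htb)
  eVariationOn_eq r r' hr hrr' hr' :=
    hV.eVariationOn_eq r r' (has.trans hr) hrr' (hr'.trans htb)

lemma hasGaugeIntegral_diff_sub_abs_diff (hV : IsVariationOn h V a b) (hab : a ≤ b) :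
    HasGaugeIntegral (fun p => p.diff V - |p.diff h|) a b 0 := by
  have h_eq := hV.eVariationOn_eq a b le_rfl hab le_rfl
  have h_abs := hasGaugeIntegral_abs_diff (h_eq ▸ ENNReal.ofReal_ne_top : BoundedVariationOn h _)
  rw [h_eq, ENNReal.toReal_ofReal (sub_nonneg.2 (hV.monotoneOn (left_mem_Icc.2 hab)
    (right_mem_Icc.2 hab) hab))] at h_abs
  simpa only [sub_self] using (HasGaugeIntegral.diff V a b).sub h_abs

end IsVariationOn

lemma isVariationOn_of_monotoneOn {V : ℝ → ℝ} {a b : ℝ} (hV : MonotoneOn V (Icc a b)) :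
    IsVariationOn V V a b where
  monotoneOn := hV
  eVariationOn_eq s t has hst htb := by
    simpa only [inter_self] using (hV.mono (Icc_subset_Icc has htb)).eVariationOn_eq
      (left_mem_Icc.2 hst) (right_mem_Icc.2 hst)

lemma isVariationOn_toReal_eVariationOn {h : ℝ → ℝ} {a b : ℝ}
    (H : BoundedVariationOn h (Icc a b)) :
    IsVariationOn h (fun t => (eVariationOn h (Icc a t)).toReal) a b where
  monotoneOn s _ t ht hst := ENNReal.toReal_mono (H.mono (Icc_subset_Icc_right ht.2))
    (eVariationOn.mono h (Icc_subset_Icc_right hst))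
  eVariationOn_eq s t has hst htb := by
    have h_split := eVariationOn.Icc_add_Icc h has hst (mem_univ s)
    simp only [univ_inter] at h_split
    have h_left : eVariationOn h (Icc a s) ≠ ⊤ := H.mono (Icc_subset_Icc_right (hst.trans htb))
    have h_right : eVariationOn h (Icc s t) ≠ ⊤ := H.mono (Icc_subset_Icc has htb)
    rw [← h_split, ENNReal.toReal_add h_left h_right, add_sub_cancel_left,
      ENNReal.ofReal_toReal h_right]

/-! ### The Kurzweil–Stieltjes integral of real functions -/

/-- The Kurzweil–Stieltjes integral `∫_a^b u dh` of a real function, as a gauge integral over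
fine partitions. -/
def HasKSIntegral (u h : ℝ → ℝ) (a b I : ℝ) : Prop :=
  HasGaugeIntegral (fun p => u p.tag * p.diff h) a b I

namespace HasKSIntegral

variable {u v w h V : ℝ → ℝ} {a b I J : ℝ}

lemma congr (H : HasKSIntegral u h a b I) (huv : ∀ t ∈ Icc a b, u t = v t) :
    HasKSIntegral v h a b I :=
  HasGaugeIntegral.congr H fun p hp => by rw [huv _ hp.tag_mem]

lemma add (H : HasKSIntegral u h a b I) (H' : HasKSIntegral v h a b J) :
    HasKSIntegral (fun t => u t + v t) h a b (I + J) := by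
  simpa only [HasKSIntegral, add_mul] using HasGaugeIntegral.add H H'

lemma const_mul (r : ℝ) (H : HasKSIntegral u h a b I) :
    HasKSIntegral (fun t => r * u t) h a b (r * I) := by
  simpa only [HasKSIntegral, mul_assoc] using HasGaugeIntegral.const_mul r H

lemma sub (H : HasKSIntegral u h a b I) (H' : HasKSIntegral v h a b J) :
    HasKSIntegral (fun t => u t - v t) h a b (I - J) := by
  simpa only [HasKSIntegral, sub_mul] using HasGaugeIntegral.sub H H'

lemma mono (hV : MonotoneOn V (Icc a b)) (hab : a ≤ b) (H : HasKSIntegral u V a b I)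
    (H' : HasKSIntegral v V a b J) (huv : ∀ t ∈ Icc a b, u t ≤ v t) : I ≤ J :=
  HasGaugeIntegral.le hab H H' fun _ hp =>
    mul_le_mul_of_nonneg_right (huv _ hp.tag_mem) (hp.diff_nonneg hV)

lemma abs_tag_mul_diff_le (hV : IsVariationOn h V a b) (huw : ∀ t ∈ Icc a b, |u t| ≤ w t)
    {p : Cell} (hp : p.IsIn a b) : |u p.tag * p.diff h| ≤ w p.tag * p.diff V := by
  rw [abs_mul]
  exact mul_le_mul (huw _ hp.tag_mem) (hV.abs_diff_le hp) (abs_nonneg _)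
    ((abs_nonneg _).trans (huw _ hp.tag_mem))

lemma abs_le (hV : IsVariationOn h V a b) (hab : a ≤ b) (H : HasKSIntegral u h a b I)
    (H' : HasKSIntegral w V a b J) (huw : ∀ t ∈ Icc a b, |u t| ≤ w t) : |I| ≤ J :=
  abs_le'.2 ⟨HasGaugeIntegral.le hab H H' fun _ hp =>
    (le_abs_self _).trans (abs_tag_mul_diff_le hV huw hp),
    HasGaugeIntegral.le hab (HasGaugeIntegral.neg H) H' fun _ hp =>
      (neg_le_abs _).trans (abs_tag_mul_diff_le hV huw hp)⟩

lemma exists_indefinite (hab : a ≤ b) (H : HasKSIntegral u h a b I) :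
    ∃ G : ℝ → ℝ, G a = 0 ∧ ∀ s t, a ≤ s → s ≤ t → t ≤ b → HasKSIntegral u h s t (G t - G s) :=
  HasGaugeIntegral.exists_indefinite hab H

/-! ### Absolute integrability and convergence theorems -/

lemma exists_abs (hV : IsVariationOn h V a b) (hab : a ≤ b) (hu : HasKSIntegral u h a b I)
    (hw : HasKSIntegral w V a b J) (huw : ∀ t ∈ Icc a b, |u t| ≤ w t) :
    ∃ K, HasKSIntegral (fun t => |u t|) V a b K := by
  -- The sums of `|u| dV`, `|u| |dh|` and `|dG|` are eventually close to each other, and the last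
  -- ones converge to the variation of `G`.
  obtain ⟨G, -, hG⟩ := hu.exists_indefinite hab
  obtain ⟨W, -, hW⟩ := hw.exists_indefinite hab
  have hG_bv : BoundedVariationOn G (Icc a b) :=
    boundedVariationOn_of_dist_le (M := W) fun s t has hst htb => by
      rw [dist_comm, Real.dist_eq]
      exact (hG s t has hst htb).abs_le (hV.mono has htb) hst (hW s t has hst htb)
        fun r hr => huw r ⟨has.trans hr.1, hr.2.trans htb⟩
  have h_dG_dh : HasGaugeIntegral (fun p => |u p.tag * p.diff h| - |p.diff G|) a b 0 :=
    (saks_henstock hG hab).zero_of_abs_le fun p _ => abs_abs_sub_abs_le _ _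
  have h_dh_dV : HasGaugeIntegral (fun p => |u p.tag| * (p.diff V - |p.diff h|)) a b 0 :=
    (hV.hasGaugeIntegral_diff_sub_abs_diff hab).mul_abs_tag
      (fun p hp => sub_nonneg.2 (hV.abs_diff_le hp)) u
  refine ⟨_, (((hasGaugeIntegral_abs_diff hG_bv).add h_dG_dh).add h_dh_dV).congr fun p _ => ?_⟩
  rw [abs_mul]
  ring

lemma exists_max (hV : MonotoneOn V (Icc a b)) (hab : a ≤ b) {K : ℝ}
    (hu : HasKSIntegral u V a b I) (hv : HasKSIntegral v V a b J) (hw : HasKSIntegral w V a b K)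
    (huw : ∀ t ∈ Icc a b, |u t| ≤ w t) (hvw : ∀ t ∈ Icc a b, |v t| ≤ w t) :
    ∃ L, HasKSIntegral (fun t => max (u t) (v t)) V a b L := by
  obtain ⟨L, hL⟩ := exists_abs (isVariationOn_of_monotoneOn hV) hab (hu.sub hv) (hw.add hw)
    fun t ht => (abs_sub _ _).trans (add_le_add (huw t ht) (hvw t ht))
  refine ⟨_, (((hu.add hv).add hL).const_mul 2⁻¹).congr fun t _ => ?_⟩
  linarith [max_add_min (u t) (v t), max_sub_min_eq_abs' (u t) (v t)]

end HasKSIntegral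

namespace HasKSIntegral

section Monotone

variable {V : ℝ → ℝ} {a b L : ℝ} {w : ℕ → ℝ → ℝ} {w' : ℝ → ℝ} {J : ℕ → ℝ}

lemma eventually_sum_le_of_monotone (hV : MonotoneOn V (Icc a b))
    (hw : ∀ k, HasKSIntegral (w k) V a b (J k)) (hmono : ∀ t ∈ Icc a b, Monotone fun k => w k t)
    (hlim : ∀ t ∈ Icc a b, Tendsto (fun k => w k t) atTop (𝓝 (w' t))) (hJ : ∀ k, J k ≤ L)
    {ε : ℝ} (hε : 0 < ε) :
    ∀ᶠ l in fineFilter a b,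
      (l.map fun p => w' p.tag * p.diff V).sum ≤ L + ε * (V b - V a + 2) := by
  choose! N hN using fun t (ht : t ∈ Icc a b) =>
    ((hlim t ht).eventually (lt_mem_nhds (sub_lt_self (w' t) hε))).exists
  have h_glue := eventually_sum_sum_range_le (C := L - J 0)
    (ψ := fun k p => (w (k + 1) p.tag - w k p.tag) * p.diff V) (J := fun k => J (k + 1) - J k)
    (fun k p hp => mul_nonneg (sub_nonneg.2 (hmono _ hp.tag_mem k.le_succ)) (hp.diff_nonneg hV))
    (fun k => (hw (k + 1)).sub (hw k))
    (fun n => by rw [Finset.sum_range_sub]; exact sub_le_sub_right (hJ n) _) N hε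
  filter_upwards [eventually_finePartition_one a b, h_glue,
    HasGaugeIntegral.eventually_le (hw 0) hε] with l hl h_incr h_first
  have h_split : (l.map fun p => w' p.tag * p.diff V).sum ≤
      (l.map fun p => ε * p.diff V + w 0 p.tag * p.diff V +
        ∑ k ∈ Finset.range (N p.tag), (w (k + 1) p.tag - w k p.tag) * p.diff V).sum := by
    refine hl.sum_map_le_sum_map fun p hp => ?_
    rw [← Finset.sum_mul, Finset.sum_range_sub fun k => w k p.tag, ← add_mul, ← add_mul]
    refine mul_le_mul_of_nonneg_right ?_ (hp.diff_nonneg hV)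
    linarith [hN _ hp.tag_mem]
  rw [List.sum_map_add, List.sum_map_add, List.sum_map_mul_left, hl.sum_map_diff V] at h_split
  linarith

lemma of_monotone (hV : MonotoneOn V (Icc a b)) (hab : a ≤ b)
    (hw : ∀ k, HasKSIntegral (w k) V a b (J k)) (hmono : ∀ t ∈ Icc a b, Monotone fun k => w k t)
    (hlim : ∀ t ∈ Icc a b, Tendsto (fun k => w k t) atTop (𝓝 (w' t)))
    (hJ : Tendsto J atTop (𝓝 L)) : HasKSIntegral w' V a b L := by
  have hJ_mono : Monotone J := monotone_nat_of_le_succ fun k =>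
    (hw k).mono hV hab (hw (k + 1)) fun t ht => hmono t ht k.le_succ
  refine tendsto_order.2 ⟨fun r hr => ?_, fun r hr => ?_⟩
  · obtain ⟨k, hk⟩ := (hJ.eventually (lt_mem_nhds hr)).exists
    filter_upwards [(hw k).eventually (lt_mem_nhds hk), eventually_finePartition_one a b]
      with l h_lt hl
    exact h_lt.trans_le (hl.sum_map_le_sum_map fun p hp => mul_le_mul_of_nonneg_right
      ((hmono _ hp.tag_mem).ge_of_tendsto (hlim _ hp.tag_mem) k) (hp.diff_nonneg hV))
  · obtain ⟨ε, hε, hεr⟩ := exists_pos_mul_lt (sub_pos.2 hr) (V b - V a + 2)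
    filter_upwards [eventually_sum_le_of_monotone hV hw hmono hlim (hJ_mono.ge_of_tendsto hJ) hε]
      with l h_le
    linarith

lemma exists_iSup {ι : Type*} [Countable ι] [Nonempty ι] (hV : MonotoneOn V (Icc a b))
    (hab : a ≤ b) {u : ι → ℝ → ℝ} {v : ℝ → ℝ} {K : ℝ}
    (hu : ∀ i, ∃ I, HasKSIntegral (u i) V a b I) (hv : HasKSIntegral v V a b K)
    (huv : ∀ i, ∀ t ∈ Icc a b, |u i t| ≤ v t) :
    ∃ I, HasKSIntegral (fun t => ⨆ i, u i t) V a b I := by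
  obtain ⟨e, he⟩ := exists_surjective_nat ι
  set w : ℕ → ℝ → ℝ := fun n t => partialSups (fun i => u (e i) t) n
  have hw : ∀ n, (∃ I, HasKSIntegral (w n) V a b I) ∧ ∀ t ∈ Icc a b, |w n t| ≤ v t := by
    intro n
    induction n with
    | zero => exact ⟨hu (e 0), huv (e 0)⟩
    | succ n ih =>
      obtain ⟨⟨I, hI⟩, ih⟩ := ih
      obtain ⟨I', hI'⟩ := hu (e (n + 1))
      simp only [w, partialSups_add_one]
      exact ⟨exists_max hV hab hI hI' hv ih (huv _), fun t ht =>
        abs_max_le_max_abs_abs.trans (max_le (ih t ht) (huv _ t ht))⟩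
  choose J hJ using fun n => (hw n).1
  have hJ_mono : Monotone J := monotone_nat_of_le_succ fun k =>
    (hJ k).mono hV hab (hJ (k + 1)) fun t _ => (partialSups _).monotone k.le_succ
  have hJ_bdd : BddAbove (range J) := ⟨K, forall_mem_range.2 fun n =>
    (hJ n).mono hV hab hv fun t ht => (le_abs_self _).trans ((hw n).2 t ht)⟩
  refine ⟨_, of_monotone hV hab hJ (fun t _ => (partialSups _).monotone) (fun t ht => ?_)
    (tendsto_atTop_ciSup hJ_mono hJ_bdd)⟩
  have hu_bdd : BddAbove (range fun n => u (e n) t) :=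
    ⟨v t, forall_mem_range.2 fun n => (le_abs_self _).trans (huv _ t ht)⟩
  rw [← he.iSup_comp, ← ciSup_partialSups_eq hu_bdd]
  exact tendsto_atTop_ciSup (partialSups _).monotone (bddAbove_range_partialSups.2 hu_bdd)

lemma tendsto_zero_of_antitone (hV : MonotoneOn V (Icc a b)) (hab : a ≤ b)
    (hw : ∀ k, HasKSIntegral (w k) V a b (J k)) (hanti : ∀ t ∈ Icc a b, Antitone fun k => w k t)
    (hlim : ∀ t ∈ Icc a b, Tendsto (fun k => w k t) atTop (𝓝 0)) : Tendsto J atTop (𝓝 0) := by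
  have hJ_anti : Antitone J := antitone_nat_of_succ_le fun k =>
    (hw (k + 1)).mono hV hab (hw k) fun t ht => hanti t ht k.le_succ
  have hJ_nonneg : ∀ n, 0 ≤ J n := fun n => by
    have h_zero : HasKSIntegral (fun _ => 0) V a b 0 := by
      simpa only [sub_self] using (hw n).sub (hw n)
    exact h_zero.mono hV hab (hw n) fun t ht => (hanti t ht).le_of_tendsto (hlim t ht) n
  have hJ_lim := tendsto_atTop_ciInf hJ_anti ⟨0, forall_mem_range.2 hJ_nonneg⟩
  have h_first : HasKSIntegral (w 0) V a b (J 0 - ⨅ i, J i) :=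
    of_monotone hV hab (fun k => (hw 0).sub (hw k))
      (fun t ht _ _ hij => sub_le_sub_left (hanti t ht hij) _)
      (fun t ht => by simpa only [sub_zero] using (hlim t ht).const_sub (w 0 t))
      (hJ_lim.const_sub (J 0))
  have h_eq := HasGaugeIntegral.unique hab h_first (hw 0)
  rwa [show ⨅ i, J i = 0 by linarith] at hJ_lim

end Monotone

end HasKSIntegral

/-- The oscillation at `t` of the sequence `u n, u (n + 1), …`, the dominating function of the
dominated convergence theorem. -/
noncomputable def tailOscillation (u : ℕ → ℝ → ℝ) (n : ℕ) (t : ℝ) : ℝ :=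
  ⨆ i : ℕ × ℕ, |u (n + i.1) t - u (n + i.2) t|

section TailOscillation

variable {u : ℕ → ℝ → ℝ} {c t : ℝ}

lemma abs_sub_le_two_mul (hu : ∀ k, |u k t| ≤ c) (k l : ℕ) : |u k t - u l t| ≤ 2 * c := by
  rw [two_mul]
  exact (abs_sub _ _).trans (add_le_add (hu k) (hu l))

lemma abs_sub_le_tailOscillation (hu : ∀ k, |u k t| ≤ c) {n k l : ℕ} (hk : n ≤ k) (hl : n ≤ l) :
    |u k t - u l t| ≤ tailOscillation u n t := by
  have h_bdd : BddAbove (range fun i : ℕ × ℕ => |u (n + i.1) t - u (n + i.2) t|) :=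
    ⟨2 * c, forall_mem_range.2 fun _ => abs_sub_le_two_mul hu _ _⟩
  simpa only [tailOscillation, Nat.add_sub_cancel' hk, Nat.add_sub_cancel' hl] using
    le_ciSup h_bdd (k - n, l - n)

lemma tailOscillation_le {n : ℕ} {r : ℝ} (h : ∀ k l, n ≤ k → n ≤ l → |u k t - u l t| ≤ r) :
    tailOscillation u n t ≤ r :=
  ciSup_le fun _ => h _ _ (Nat.le_add_right _ _) (Nat.le_add_right _ _)

lemma antitone_tailOscillation (hu : ∀ k, |u k t| ≤ c) :
    Antitone fun n => tailOscillation u n t := fun _ _ hmn =>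
  tailOscillation_le fun _ _ hk hl =>
    abs_sub_le_tailOscillation hu (hmn.trans hk) (hmn.trans hl)

lemma tendsto_tailOscillation_zero (hu : ∀ k, |u k t| ≤ c) {y : ℝ}
    (hy : Tendsto (fun k => u k t) atTop (𝓝 y)) :
    Tendsto (fun n => tailOscillation u n t) atTop (𝓝 0) := by
  refine Metric.tendsto_atTop.2 fun ε hε => ?_
  obtain ⟨N, hN⟩ := Metric.cauchySeq_iff.1 hy.cauchySeq (ε / 2) (half_pos hε)
  refine ⟨N, fun n hn => ?_⟩
  have h_le : tailOscillation u n t ≤ ε / 2 := tailOscillation_le fun k l hk hl =>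
    (hN k (hn.trans hk) l (hn.trans hl)).le
  have h_nonneg : 0 ≤ tailOscillation u n t :=
    (abs_nonneg _).trans (abs_sub_le_tailOscillation hu (le_refl n) (le_refl n))
  rw [Real.dist_eq, sub_zero, abs_of_nonneg h_nonneg]
  linarith

end TailOscillation

namespace HasKSIntegral

variable {h V : ℝ → ℝ} {a b : ℝ}

lemma of_abs_sub_le (hV : IsVariationOn h V a b) {u : ℕ → ℝ → ℝ} {w : ℕ → ℝ → ℝ} {v : ℝ → ℝ}
    {I J : ℕ → ℝ} {L : ℝ} (hu : ∀ n, HasKSIntegral (u n) h a b (I n))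
    (hw : ∀ n, HasKSIntegral (w n) V a b (J n)) (hvu : ∀ n, ∀ t ∈ Icc a b, |v t - u n t| ≤ w n t)
    (hI : Tendsto I atTop (𝓝 L)) (hJ : Tendsto J atTop (𝓝 0)) : HasKSIntegral v h a b L := by
  refine Metric.tendsto_nhds.2 fun ε hε => ?_
  have hε4 : 0 < ε / 4 := by positivity
  obtain ⟨n, hIn, hJn⟩ :=
    ((Metric.tendsto_nhds.1 hI _ hε4).and (hJ.eventually (gt_mem_nhds hε4))).exists
  filter_upwards [Metric.tendsto_nhds.1 (hu n) _ hε4, HasGaugeIntegral.eventually_le (hw n) hε4,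
    eventually_finePartition_one a b] with l hun hwn hl
  have h_split : (l.map fun p => v p.tag * p.diff h).sum = (l.map fun p => u n p.tag * p.diff h).sum
      + (l.map fun p => (v p.tag - u n p.tag) * p.diff h).sum := by
    simp only [← List.sum_map_add, ← add_mul, add_sub_cancel]
  have h_diff : |(l.map fun p => (v p.tag - u n p.tag) * p.diff h).sum| ≤
      (l.map fun p => w n p.tag * p.diff V).sum :=
    (abs_sum_map_le _ _).trans (hl.sum_map_le_sum_map fun p hp =>
      abs_tag_mul_diff_le (u := fun t => v t - u n t) hV (hvu n) hp)
  rw [Real.dist_eq, abs_lt] at *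
  rw [abs_le'] at h_diff
  constructor <;> linarith

lemma exists_integral_tailOscillation (hV : IsVariationOn h V a b) (hab : a ≤ b)
    {u : ℕ → ℝ → ℝ} {v w : ℝ → ℝ} {I : ℕ → ℝ} {K : ℝ}
    (hu : ∀ k, HasKSIntegral (u k) h a b (I k)) (hw : HasKSIntegral w V a b K)
    (huw : ∀ k, ∀ t ∈ Icc a b, |u k t| ≤ w t)
    (hlim : ∀ t ∈ Icc a b, Tendsto (fun k => u k t) atTop (𝓝 (v t))) :
    ∃ J : ℕ → ℝ, (∀ n, HasKSIntegral (tailOscillation u n) V a b (J n)) ∧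
      Tendsto J atTop (𝓝 0) := by
  have h_diff : ∀ k l, ∀ t ∈ Icc a b, |u k t - u l t| ≤ 2 * w t := fun k l t ht =>
    abs_sub_le_two_mul (fun k => huw k t ht) k l
  choose J hJ using fun n => exists_iSup hV.monotoneOn hab
    (fun i : ℕ × ℕ => exists_abs hV hab ((hu (n + i.1)).sub (hu (n + i.2))) (hw.const_mul 2)
      (h_diff _ _)) (hw.const_mul 2) fun i t ht => (abs_abs _).trans_le (h_diff _ _ t ht)
  exact ⟨J, hJ, tendsto_zero_of_antitone hV.monotoneOn hab hJ
    (fun t ht => antitone_tailOscillation fun k => huw k t ht)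
    fun t ht => tendsto_tailOscillation_zero (fun k => huw k t ht) (hlim t ht)⟩

lemma exists_of_dominated (hV : IsVariationOn h V a b) (hab : a ≤ b)
    {u : ℕ → ℝ → ℝ} {v w : ℝ → ℝ} {I : ℕ → ℝ} {K : ℝ}
    (hu : ∀ k, HasKSIntegral (u k) h a b (I k)) (hw : HasKSIntegral w V a b K)
    (huw : ∀ k, ∀ t ∈ Icc a b, |u k t| ≤ w t)
    (hlim : ∀ t ∈ Icc a b, Tendsto (fun k => u k t) atTop (𝓝 (v t))) :
    ∃ L, HasKSIntegral v h a b L ∧ Tendsto I atTop (𝓝 L) := by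
  obtain ⟨J, hJ, hJ_zero⟩ := exists_integral_tailOscillation hV hab hu hw huw hlim
  have hI_cauchy : CauchySeq I := by
    refine Metric.cauchySeq_iff'.2 fun ε hε => ?_
    obtain ⟨N, hN⟩ := (hJ_zero.eventually (gt_mem_nhds hε)).exists
    refine ⟨N, fun n hn => lt_of_le_of_lt ?_ hN⟩
    exact ((hu n).sub (hu N)).abs_le hV hab (hJ N) fun t ht =>
      abs_sub_le_tailOscillation (fun k => huw k t ht) hn le_rfl
  obtain ⟨L, hL⟩ := cauchySeq_tendsto_of_complete hI_cauchy
  refine ⟨L, of_abs_sub_le hV hu hJ (fun n t ht => ?_) hL hJ_zero, hL⟩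
  exact le_of_tendsto ((hlim t ht).sub_const (u n t)).abs (eventually_atTop.2
    ⟨n, fun k hk => abs_sub_le_tailOscillation (fun k => huw k t ht) hk le_rfl⟩)

end HasKSIntegral

/-! ### Integrals along a function -/

section LeftContinuous

variable {u v h : ℝ → ℝ} {a b I : ℝ}

lemma hasKSIntegral_zero_of_eq_zero_on_Ico (hu : ∀ t ∈ Ico a b, u t = 0)
    (h_left : ContinuousWithinAt h (Iic b) b) : HasKSIntegral u h a b 0 := by
  refine Metric.tendsto_nhds.2 fun ε hε => ?_
  have h_small : ∀ᶠ s in 𝓝[≤] b, |u b * (h b - h s)| < ε / 2 := by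
    have h_lim := ((h_left.tendsto.const_sub (h b)).const_mul (u b)).abs
    rw [sub_self, mul_zero, abs_zero] at h_lim
    exact h_lim.eventually (gt_mem_nhds (half_pos hε))
  obtain ⟨c, hcb, hc⟩ := mem_nhdsLE_iff_exists_Ioc_subset.1 h_small
  filter_upwards [eventually_finePartition (fun _ => sub_pos.2 hcb) a b] with l hl
  -- Only a last cell tagged at `b` contributes, and the jump of `W` at `b` pays for it.
  set W : ℝ → ℝ := fun t => if t = b then ε / 2 else 0 with hW
  have h_cell : ∀ p ∈ l, |u p.tag * p.diff h| ≤ p.diff W := fun p hp => by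
    have hp_in := hl.isIn hp
    have h_left_ne : p.left ≠ b := (hp_in.left_lt_right.trans_le hp_in.right_le).ne
    rcases hp_in.tag_mem.2.eq_or_lt with h_tag | h_tag
    · have h_right : p.right = b := by rcases hp_in.tag_eq with h_eq | h_eq <;> grind
      have h_mem : p.left ∈ Ioc c b := by
        have := hl.right_sub_left_lt hp
        exact ⟨by linarith, hp_in.left_mem.2⟩
      simpa only [Cell.diff, hW, h_tag, h_right, h_left_ne, if_true, if_false, sub_zero]
        using (show |_| < _ from hc h_mem).le
    · rw [hu _ ⟨hp_in.tag_mem.1, h_tag⟩, zero_mul, abs_zero, Cell.diff, hW]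
      grind
  calc dist (l.map fun p => u p.tag * p.diff h).sum 0
      ≤ (l.map fun p => |u p.tag * p.diff h|).sum := by
        rw [Real.dist_eq, sub_zero]
        exact abs_sum_map_le _ _
    _ ≤ (l.map fun p => p.diff W).sum := List.sum_le_sum h_cell
    _ = W b - W a := hl.sum_map_diff W
    _ < ε := by grind

lemma HasKSIntegral.congr_Ico (H : HasKSIntegral u h a b I) (huv : ∀ t ∈ Ico a b, u t = v t)
    (h_left : ContinuousWithinAt h (Iic b) b) : HasKSIntegral v h a b I := by
  have h_zero := hasKSIntegral_zero_of_eq_zero_on_Ico (u := fun t => v t - u t)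
    (fun t ht => sub_eq_zero.2 (huv t ht).symm) h_left
  simpa only [add_sub_cancel, add_zero] using H.add h_zero

end LeftContinuous

open Classical in
/-- The step function which on each half-open cell `[left, right)` of `l` takes the tag of the
cell as its value, and `s ↦ s` outside the cells. -/
noncomputable def tagAt : List Cell → ℝ → ℝ
  | [], s => s
  | p :: l, s => if s ∈ Ico p.left p.right then p.tag else tagAt l s

lemma tagAt_eq_self_or (l : List Cell) (s : ℝ) :
    tagAt l s = s ∨ ∃ p ∈ l, s ∈ Ico p.left p.right ∧ tagAt l s = p.tag := by
  induction l with
  | nil => exact .inl rfl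
  | cons p l ih =>
    by_cases hs : s ∈ Ico p.left p.right
    · exact .inr ⟨p, List.mem_cons_self, hs, if_pos hs⟩
    · rw [tagAt, if_neg hs]
      exact ih.imp_right fun ⟨q, hq, h⟩ => ⟨q, List.mem_cons_of_mem _ hq, h⟩

section TagAt

variable {δ : ℝ → ℝ} {a b c s τ : ℝ} {l : List Cell}

lemma tagAt_cons_of_mem_Ico (hs : s ∈ Ico a c) : tagAt (⟨a, τ, c⟩ :: l) s = τ :=
  if_pos hs

lemma tagAt_cons_of_le (hs : c ≤ s) : tagAt (⟨a, τ, c⟩ :: l) s = tagAt l s :=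
  if_neg fun h => hs.not_gt h.2

namespace FinePartition

lemma tagAt_mem_Icc (H : FinePartition δ a b l) (hs : s ∈ Icc a b) : tagAt l s ∈ Icc a b := by
  rcases tagAt_eq_self_or l s with h | ⟨p, hp, -, h⟩ <;> rw [h]
  exacts [hs, (H.isIn hp).tag_mem]

lemma tagAt_eq_self_or_abs_sub_lt (H : FinePartition δ a b l) (s : ℝ) :
    tagAt l s = s ∨ |tagAt l s - s| < δ (tagAt l s) := by
  refine (tagAt_eq_self_or l s).imp_right ?_
  rintro ⟨p, hp, hs, h⟩
  rw [h, abs_lt]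
  have h_lt := H.right_sub_left_lt hp
  rcases (H.isIn hp).tag_eq with h_tag | h_tag <;> constructor <;> linarith [hs.1, hs.2]

lemma hasKSIntegral_tagAt {h : ℝ → ℝ} {k K : ℝ → ℝ → ℝ} (H : FinePartition δ a b l)
    (h_left : ∀ t ∈ Ioc a b, ContinuousWithinAt h (Iic t) t)
    (hK : ∀ τ ∈ Icc a b, ∀ s t, a ≤ s → s ≤ t → t ≤ b →
      HasKSIntegral (k τ) h s t (K τ t - K τ s)) :
    HasKSIntegral (fun s => k (tagAt l s) s) h a b (l.map fun p => p.diff (K p.tag)).sum := by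
  induction H with
  | nil a => exact HasGaugeIntegral.self _ a
  | @cons a b c τ l hac hτ _ hl ih =>
    have hτ_mem : τ ∈ Icc a b := Cell.IsIn.tag_mem (p := ⟨a, τ, c⟩) ⟨le_rfl, hac, hl.le, hτ⟩
    have h_head : HasKSIntegral (fun s => k (tagAt (⟨a, τ, c⟩ :: l) s) s) h a c
        (K τ c - K τ a) :=
      (hK τ hτ_mem a c le_rfl hac.le hl.le).congr_Ico
        (fun s hs => by rw [tagAt_cons_of_mem_Ico hs]) (h_left c ⟨hac, hl.le⟩)
    have h_tail : HasKSIntegral (fun s => k (tagAt (⟨a, τ, c⟩ :: l) s) s) h c b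
        (l.map fun p => p.diff (K p.tag)).sum :=
      (ih (fun t ht => h_left t ⟨hac.trans ht.1, ht.2⟩)
        fun τ hτ s t hs => hK τ ⟨hac.le.trans hτ.1, hτ.2⟩ s t (hac.le.trans hs)).congr
        fun s hs => by rw [tagAt_cons_of_le hs.1]
    rw [List.map_cons, List.sum_cons]
    exact HasGaugeIntegral.trans hac.le hl.le h_head h_tail

lemma aestronglyMeasurable_tagAt {E : Type*} [TopologicalSpace E]
    [TopologicalSpace.PseudoMetrizableSpace E] {k : ℝ → ℝ → E}
    (H : FinePartition δ a b l)
    (hk : ∀ τ ∈ Icc a b, AEStronglyMeasurable (k τ) (volume.restrict (Icc a b))) :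
    AEStronglyMeasurable (fun s => k (tagAt l s) s) (volume.restrict (Icc a b)) := by
  induction H with
  | nil a => simp
  | @cons a b c τ l hac hτ _ hl ih =>
    have hτ_mem : τ ∈ Icc a b := Cell.IsIn.tag_mem (p := ⟨a, τ, c⟩) ⟨le_rfl, hac, hl.le, hτ⟩
    rw [← Ico_union_Icc_eq_Icc hac.le hl.le, aestronglyMeasurable_union_iff]
    have hleft : Ico a c ⊆ Icc a b := Ico_subset_Icc_self.trans (Icc_subset_Icc_right hl.le)
    have hright : Icc c b ⊆ Icc a b := Icc_subset_Icc_left hac.le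
    constructor
    · refine ((hk τ hτ_mem).mono_set hleft).congr ?_
      filter_upwards [ae_restrict_mem measurableSet_Ico] with s hs
      rw [tagAt_cons_of_mem_Ico hs]
    · refine (ih fun τ hτ => (hk τ (hright hτ)).mono_set hright).congr ?_
      filter_upwards [ae_restrict_mem measurableSet_Icc] with s hs
      rw [tagAt_cons_of_le hs.1]

end FinePartition

end TagAt

section GaugeSequence

variable {a b : ℝ}

lemma tendsto_fineFilter_of_seq {X : Type*} [PseudoMetricSpace X] {Φ : List Cell → X} {I : X}
    {δ : ℕ → ℝ → ℝ} (hδ : ∀ j t, 0 < δ j t)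
    (H : ∀ l : ℕ → List Cell, (∀ j, FinePartition (δ j) a b (l j)) →
      Tendsto (fun j => Φ (l j)) atTop (𝓝 I)) : Tendsto Φ (fineFilter a b) (𝓝 I) := by
  refine Metric.tendsto_nhds.2 fun ε hε => ?_
  by_contra h_not
  choose l hl h_far using fun j => ((eventually_finePartition (hδ j) a b).and_frequently
    (not_eventually.1 h_not)).exists
  obtain ⟨j, hj⟩ := (Metric.tendsto_nhds.1 (H l hl) ε hε).exists
  exact h_far j hj

lemma exists_gauge_away_from_finite (d : ℕ → ℝ) (j : ℕ) (t : ℝ) :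
    ∃ η > 0, η ≤ 1 / ((j : ℝ) + 1) ∧ ∀ i ∈ Finset.range j, t ≠ d i → η ≤ |t - d i| := by
  have h_le : ∀ r : ℝ, 0 < r → ∀ᶠ η in 𝓝[>] (0 : ℝ), η ≤ r := fun r hr =>
    nhdsWithin_le_nhds (Iic_mem_nhds hr)
  have h_away : ∀ᶠ η in 𝓝[>] (0 : ℝ), ∀ i ∈ Finset.range j, t ≠ d i → η ≤ |t - d i| := by
    refine (Filter.eventually_all_finset _).2 fun i _ => ?_
    by_cases h : t = d i
    · exact Eventually.of_forall fun _ hne => absurd h hne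
    · filter_upwards [h_le _ (abs_pos.2 (sub_ne_zero.2 h))] with η hη _ using hη
  obtain ⟨η, hη, h⟩ := (eventually_mem_nhdsWithin.and
    ((h_le _ Nat.one_div_pos_of_nat).and h_away)).exists
  exact ⟨η, hη, h⟩

lemma exists_seq_gauge_tendsto_tagAt {D : Set ℝ} (hD : D.Countable) (a b : ℝ) :
    ∃ δ : ℕ → ℝ → ℝ, (∀ j t, 0 < δ j t) ∧
      ∀ l : ℕ → List Cell, (∀ j, FinePartition (δ j) a b (l j)) → ∀ s,
        Tendsto (fun j => tagAt (l j) s) atTop (𝓝 s) ∧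
        (s ∈ D → ∀ᶠ j in atTop, tagAt (l j) s = s) := by
  obtain ⟨d, hDd⟩ := Set.countable_iff_exists_subset_range.1 hD
  choose δ hδ_pos hδ_le hδ_away using exists_gauge_away_from_finite d
  refine ⟨δ, hδ_pos, fun l hl s => ⟨?_, fun hs => ?_⟩⟩
  · refine tendsto_iff_dist_tendsto_zero.2 (squeeze_zero (fun _ => dist_nonneg) (fun j => ?_)
      tendsto_one_div_add_atTop_nhds_zero_nat)
    rcases (hl j).tagAt_eq_self_or_abs_sub_lt s with h | h
    · rw [h, dist_self]
      exact Nat.one_div_pos_of_nat.le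
    · exact h.le.trans (hδ_le j _)
  · obtain ⟨i, rfl⟩ := hDd hs
    filter_upwards [eventually_gt_atTop i] with j hij
    by_contra h_ne
    exact (((hl j).tagAt_eq_self_or_abs_sub_lt _).resolve_left h_ne).not_ge
      (hδ_away j _ i (Finset.mem_range.2 hij) h_ne)

lemma exists_seq_gauge_tendsto_apply_tagAt {E : Type*} [TopologicalSpace E] {k : ℝ → ℝ → E}
    {D : Set ℝ} (hD : D.Countable) (hk : ∀ s ∈ Icc a b, s ∉ D →
      ContinuousWithinAt (fun τ => k τ s) (Icc a b) s) :
    ∃ δ : ℕ → ℝ → ℝ, (∀ j t, 0 < δ j t) ∧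
      ∀ l : ℕ → List Cell, (∀ j, FinePartition (δ j) a b (l j)) → ∀ s ∈ Icc a b,
        Tendsto (fun j => k (tagAt (l j) s) s) atTop (𝓝 (k s s)) := by
  obtain ⟨δ, hδ, H⟩ := exists_seq_gauge_tendsto_tagAt hD a b
  refine ⟨δ, hδ, fun l hl s hs => ?_⟩
  obtain ⟨h_lim, h_eq⟩ := H l hl s
  by_cases hsD : s ∈ D
  · refine tendsto_nhds_of_eventually_eq ?_
    filter_upwards [h_eq hsD] with j hj
    rw [hj]
  · exact (hk s hs hsD).tendsto.comp (tendsto_nhdsWithin_iff.2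
      ⟨h_lim, Eventually.of_forall fun j => (hl j).tagAt_mem_Icc hs⟩)

end GaugeSequence

section Diagonal

variable {a b : ℝ} {D : Set ℝ}

theorem exists_hasKSIntegral_diagonal {h V w : ℝ → ℝ} {k K : ℝ → ℝ → ℝ} {M : ℝ}
    (hV : IsVariationOn h V a b) (hab : a ≤ b)
    (h_left : ∀ t ∈ Ioc a b, ContinuousWithinAt h (Iic t) t)
    (hK : ∀ τ ∈ Icc a b, ∀ s t, a ≤ s → s ≤ t → t ≤ b →
      HasKSIntegral (k τ) h s t (K τ t - K τ s))
    (hw : HasKSIntegral w V a b M) (hkw : ∀ τ ∈ Icc a b, ∀ s ∈ Icc a b, |k τ s| ≤ w s)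
    (hD : D.Countable) (hk : ∀ s ∈ Icc a b, s ∉ D →
      ContinuousWithinAt (fun τ => k τ s) (Icc a b) s) :
    ∃ I, HasKSIntegral (fun s => k s s) h a b I ∧
      HasGaugeIntegral (fun p => p.diff (K p.tag)) a b I := by
  obtain ⟨δ, hδ, h_lim⟩ := exists_seq_gauge_tendsto_apply_tagAt hD hk
  have h_seq : ∀ l : ℕ → List Cell, (∀ j, FinePartition (δ j) a b (l j)) →
      ∃ L, HasKSIntegral (fun s => k s s) h a b L ∧
        Tendsto (fun j => ((l j).map fun p => p.diff (K p.tag)).sum) atTop (𝓝 L) := fun l hl =>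
    HasKSIntegral.exists_of_dominated hV hab (fun j => (hl j).hasKSIntegral_tagAt h_left hK) hw
      (fun j s hs => hkw _ ((hl j).tagAt_mem_Icc hs) s hs) (h_lim l hl)
  choose l hl using fun j => exists_finePartition (hδ j) hab
  obtain ⟨I, hI, -⟩ := h_seq l hl
  refine ⟨I, hI, tendsto_fineFilter_of_seq hδ fun l hl => ?_⟩
  obtain ⟨L, hL, hl_lim⟩ := h_seq l hl
  rwa [hI.unique hab hL]

lemma aestronglyMeasurable_diagonal {E : Type*} [TopologicalSpace E]
    [TopologicalSpace.PseudoMetrizableSpace E] {k : ℝ → ℝ → E}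
    (hab : a ≤ b)
    (hk_meas : ∀ τ ∈ Icc a b, AEStronglyMeasurable (k τ) (volume.restrict (Icc a b)))
    (hD : D.Countable) (hk : ∀ s ∈ Icc a b, s ∉ D →
      ContinuousWithinAt (fun τ => k τ s) (Icc a b) s) :
    AEStronglyMeasurable (fun s => k s s) (volume.restrict (Icc a b)) := by
  obtain ⟨δ, hδ, h_lim⟩ := exists_seq_gauge_tendsto_apply_tagAt hD hk
  choose l hl using fun j => exists_finePartition (hδ j) hab
  refine aestronglyMeasurable_of_tendsto_ae atTop
    (fun j => (hl j).aestronglyMeasurable_tagAt hk_meas) ?_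
  filter_upwards [ae_restrict_mem measurableSet_Icc] with s hs using h_lim l hl s hs

end Diagonal

/-! ### Regulated functions -/

section Regulated

variable {X : Type*} [PseudoMetricSpace X] {x : ℝ → X}

lemma eventually_eventually_dist_lt {S : Set ℝ} (hS : IsOpen S) {t : ℝ} {y : X}
    (H : Tendsto x (𝓝[S] t) (𝓝 y)) {ε : ℝ} (hε : 0 < ε) :
    ∀ᶠ q in 𝓝[S] t, ∀ᶠ r in 𝓝 q, dist (x r) (x q) < ε := by
  have h_near := Metric.tendsto_nhds.1 H (ε / 2) (half_pos hε)
  filter_upwards [h_near, eventually_eventually_nhdsWithin.2 h_near, self_mem_nhdsWithin]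
    with q hq hq_near hqS
  rw [hS.nhdsWithin_eq hqS] at hq_near
  filter_upwards [hq_near] with r hr
  linarith [dist_triangle_right (x r) (x q) y]

lemma RegulatedOn.countable_not_eventually_dist_lt {T : ℝ} (hx : RegulatedOn x T) {ε : ℝ}
    (hε : 0 < ε) : {t ∈ Ioo 0 T | ¬∀ᶠ r in 𝓝 t, dist (x r) (x t) < ε}.Countable := by
  set D := {t ∈ Ioo 0 T | ¬∀ᶠ r in 𝓝 t, dist (x r) (x t) < ε}
  have h_isolated : ∀ t ∈ D, {q | q = t ∨ q ∉ D} ∈ 𝓝[D] t := fun t ht => by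
    obtain ⟨y, hy⟩ := hx.1 t ⟨ht.1.1, ht.1.2.le⟩
    obtain ⟨z, hz⟩ := hx.2 t ⟨ht.1.1.le, ht.1.2⟩
    have h_punctured : ∀ᶠ q in 𝓝[≠] t, ∀ᶠ r in 𝓝 q, dist (x r) (x q) < ε := by
      rw [← nhdsLT_sup_nhdsGT, eventually_sup]
      exact ⟨eventually_eventually_dist_lt isOpen_Iio hy hε,
        eventually_eventually_dist_lt isOpen_Ioi hz hε⟩
    refine nhdsWithin_le_nhds ?_
    filter_upwards [eventually_nhdsWithin_iff.1 h_punctured] with q hq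
    exact or_iff_not_imp_left.2 fun h_ne hqD => hqD.2 (hq h_ne)
  obtain ⟨C, -, hC, hDC⟩ := TopologicalSpace.countable_cover_nhdsWithin h_isolated
  refine hC.mono fun t ht => ?_
  obtain ⟨c, hc, htc⟩ := mem_iUnion₂.1 (hDC ht)
  exact htc.resolve_right (not_not.2 ht) ▸ hc

lemma RegulatedOn.countable_not_continuousAt {T : ℝ} (hx : RegulatedOn x T) :
    {t ∈ Icc 0 T | ¬ContinuousAt x t}.Countable := by
  have h_union := (countable_iUnion fun n : ℕ => hx.countable_not_eventually_dist_lt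
    (Nat.one_div_pos_of_nat (α := ℝ) (n := n))).union (toFinite {0, T}).countable
  refine h_union.mono fun t ⟨ht, h_disc⟩ => ?_
  by_contra h_not
  simp only [mem_union, mem_iUnion, mem_insert_iff, mem_singleton_iff, not_or, not_exists] at h_not
  have ht_Ioo : t ∈ Ioo 0 T :=
    ⟨lt_of_le_of_ne ht.1 (Ne.symm h_not.2.1), lt_of_le_of_ne ht.2 h_not.2.2⟩
  refine h_disc (Metric.tendsto_nhds.2 fun ε hε => ?_)
  obtain ⟨n, hn⟩ := exists_nat_one_div_lt hε
  have h_near : ∀ᶠ r in 𝓝 t, dist (x r) (x t) < 1 / ((n : ℝ) + 1) :=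
    not_not.1 fun h => h_not.1 n ⟨ht_Ioo, h⟩
  filter_upwards [h_near] with r hr using hr.trans hn

end Regulated

/-! ### Comparison with the Kurzweil integral over tagged partitions -/

section Comparison

variable {X : Type*} [NormedAddCommGroup X] {U : ℝ → ℝ → X} {δ : ℝ → ℝ} {a b : ℝ} {I : X}

lemma FinePartition.exists_taggedPartition {l : List Cell} (H : FinePartition δ a b l)
    (U : ℝ → ℝ → X) : ∃ P : TaggedPartition a b, P.IsFine δ ∧
      P.kurzweilSum U = (l.map fun p => p.diff (U p.tag)).sum := by
  induction H with
  | nil a =>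
    refine ⟨⟨0, fun _ => a, fun _ => a, rfl, rfl, fun j hj => absurd hj j.not_lt_zero,
      fun j hj => absurd hj j.not_lt_zero⟩, fun j hj => absurd hj j.not_lt_zero, ?_⟩
    simp [TaggedPartition.kurzweilSum]
  | @cons a b c τ l hac hτ hfine _ ih =>
    obtain ⟨P, hP, hU⟩ := ih
    have hτ_mem : τ ∈ Icc a c := by rcases hτ with rfl | rfl <;> constructor <;> linarith
    refine ⟨⟨P.ν + 1, fun j => Nat.casesOn j a P.pt, fun j => Nat.casesOn j τ P.tag, rfl,
      P.pt_last, ?_, ?_⟩, ?_, ?_⟩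
    · rintro (_ | j) hj
      · simpa [P.pt_zero] using hτ_mem
      · exact P.tag_mem j (Nat.lt_of_succ_lt_succ hj)
    · rintro (_ | j) hj
      · simpa [P.pt_zero] using hac.le
      · exact P.mono j (Nat.lt_of_succ_lt_succ hj)
    · rintro (_ | j) hj
      · change Icc a (P.pt 0) ⊆ Ioo (τ - δ τ) (τ + δ τ)
        rw [P.pt_zero]
        intro s hs
        rcases hτ with rfl | rfl <;> constructor <;> linarith [hs.1, hs.2]
      · exact hP j (Nat.lt_of_succ_lt_succ hj)
    · rw [List.map_cons, List.sum_cons, ← hU, TaggedPartition.kurzweilSum,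
        Finset.sum_range_succ', add_comm]
      simp [TaggedPartition.kurzweilSum, Cell.diff, P.pt_zero]

lemma exists_finePartition_split_at_tag {s t τ : ℝ} (hτ : τ ∈ Icc s t)
    (hfine : Icc s t ⊆ Ioo (τ - δ τ) (τ + δ τ)) (U : ℝ → ℝ → X) :
    ∃ l, FinePartition δ s t l ∧ (l.map fun p => p.diff (U p.tag)).sum = U τ t - U τ s := by
  have hs := hfine (left_mem_Icc.2 (hτ.1.trans hτ.2))
  have ht := hfine (right_mem_Icc.2 (hτ.1.trans hτ.2))
  obtain ⟨l₁, hl₁, hU₁⟩ : ∃ l, FinePartition δ s τ l ∧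
      (l.map fun p => p.diff (U p.tag)).sum = U τ τ - U τ s := by
    rcases hτ.1.eq_or_lt with rfl | h_lt
    · exact ⟨[], .nil _, by simp⟩
    · exact ⟨_, .cons h_lt (.inr rfl) (by linarith [hs.1]) (.nil τ), by simp [Cell.diff]⟩
  obtain ⟨l₂, hl₂, hU₂⟩ : ∃ l, FinePartition δ τ t l ∧
      (l.map fun p => p.diff (U p.tag)).sum = U τ t - U τ τ := by
    rcases hτ.2.eq_or_lt with rfl | h_lt
    · exact ⟨[], .nil _, by simp⟩
    · exact ⟨_, .cons h_lt (.inl rfl) (by linarith [ht.2]) (.nil t), by simp [Cell.diff]⟩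
  exact ⟨l₁ ++ l₂, hl₁.append hl₂, by
    rw [List.map_append, List.sum_append, hU₁, hU₂, sub_add_sub_cancel']⟩

lemma TaggedPartition.IsFine.exists_finePartition {P : TaggedPartition a b} (hP : P.IsFine δ)
    (U : ℝ → ℝ → X) : ∃ l, FinePartition δ a b l ∧
      (l.map fun p => p.diff (U p.tag)).sum = P.kurzweilSum U := by
  have h_initial : ∀ n ≤ P.ν, ∃ l, FinePartition δ a (P.pt n) l ∧
      (l.map fun p => p.diff (U p.tag)).sum =
        ∑ j ∈ Finset.range n, (U (P.tag j) (P.pt (j + 1)) - U (P.tag j) (P.pt j)) := by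
    intro n
    induction n with
    | zero => exact fun _ => ⟨[], by rw [P.pt_zero]; exact .nil a, by simp⟩
    | succ n ih =>
      intro hn
      obtain ⟨l₁, hl₁, hU₁⟩ := ih (Nat.le_of_succ_le hn)
      obtain ⟨l₂, hl₂, hU₂⟩ := exists_finePartition_split_at_tag (P.tag_mem n hn) (hP n hn) U
      exact ⟨l₁ ++ l₂, hl₁.append hl₂, by
        rw [List.map_append, List.sum_append, hU₁, hU₂, Finset.sum_range_succ]⟩
  have h_all := h_initial P.ν le_rfl
  rwa [P.pt_last] at h_all

lemma hasKurzweilIntegral_iff_hasGaugeIntegral :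
    HasKurzweilIntegral U a b I ↔ HasGaugeIntegral (fun p => p.diff (U p.tag)) a b I := by
  constructor
  · intro H
    refine Metric.tendsto_nhds.2 fun ε hε => ?_
    obtain ⟨δ, hδ, H⟩ := H ε hε
    classical
    refine eventually_fineFilter.2 ⟨fun τ => if τ ∈ Icc a b then δ τ else 1, fun τ => ?_,
      fun l hl => ?_⟩
    · beta_reduce
      split_ifs with hτ
      exacts [hδ τ hτ, one_pos]
    · obtain ⟨P, hP, hU⟩ := (hl.mono (δ' := δ)
        fun t ht => by rw [if_pos ht]).exists_taggedPartition U
      rw [dist_eq_norm, ← hU]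
      exact H P hP
  · intro H ε hε
    obtain ⟨δ, hδ, H⟩ := eventually_fineFilter.1 (Metric.tendsto_nhds.1 H ε hε)
    refine ⟨δ, fun τ _ => hδ τ, fun P hP => ?_⟩
    obtain ⟨l, hl, hU⟩ := hP.exists_finePartition U
    rw [← hU, ← dist_eq_norm]
    exact H l hl

lemma HasKurzweilIntegral.unique (hab : a ≤ b) {J : X} (H : HasKurzweilIntegral U a b I)
    (H' : HasKurzweilIntegral U a b J) : I = J :=
  (hasKurzweilIntegral_iff_hasGaugeIntegral.1 H).unique hab
    (hasKurzweilIntegral_iff_hasGaugeIntegral.1 H')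

lemma HasKurzweilIntegral.add {U' : ℝ → ℝ → X} {J : X} (H : HasKurzweilIntegral U a b I)
    (H' : HasKurzweilIntegral U' a b J) :
    HasKurzweilIntegral (fun τ t => U τ t + U' τ t) a b (I + J) := by
  rw [hasKurzweilIntegral_iff_hasGaugeIntegral] at *
  exact (H.add H').congr fun p _ => (add_sub_add_comm ..).symm

lemma HasKurzweilIntegral.kurzweilIntegral_eq (hab : a ≤ b) (H : HasKurzweilIntegral U a b I) :
    kurzweilIntegral U a b = I := by
  have h : KurzweilIntegrable U a b := ⟨I, H⟩
  rw [kurzweilIntegral, dif_pos h]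
  exact h.choose_spec.unique hab H

lemma KSIntegrable.exists_hasKSIntegral {u h : ℝ → ℝ} (H : KSIntegrable u h a b) :
    ∃ J, HasKSIntegral u h a b J := by
  obtain ⟨J, hJ⟩ := H
  refine ⟨J, (hasKurzweilIntegral_iff_hasGaugeIntegral.1 hJ).congr fun p _ => ?_⟩
  simp only [Cell.diff, smul_eq_mul]
  ring

end Comparison

section Components

variable {n : ℕ} {a b : ℝ}

lemma tendsto_Rn_iff {α : Type*} {l : Filter α} {u : α → Rn n} {c : Rn n} :
    Tendsto u l (𝓝 c) ↔ ∀ i, Tendsto (fun s => u s i) l (𝓝 (c i)) := by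
  rw [(PiLp.homeomorph 1 fun _ : Fin n => ℝ).isInducing.tendsto_nhds_iff, tendsto_pi_nhds]
  rfl

lemma hasGaugeIntegral_iff_apply {φ : Cell → Rn n} {I : Rn n} :
    HasGaugeIntegral φ a b I ↔ ∀ i, HasGaugeIntegral (fun p => φ p i) a b (I i) := by
  refine tendsto_Rn_iff.trans (forall_congr' fun i => tendsto_congr fun l => ?_)
  rw [← PiLp.proj_apply (𝕜 := ℝ) 1 (fun _ : Fin n => ℝ) i, map_list_sum, List.map_map]
  rfl

lemma hasKurzweilIntegral_smul_iff {u : ℝ → Rn n} {h : ℝ → ℝ} {I : Rn n} :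
    HasKurzweilIntegral (fun τ t => h t • u τ) a b I ↔
      ∀ i, HasKSIntegral (fun s => u s i) h a b (I i) := by
  rw [hasKurzweilIntegral_iff_hasGaugeIntegral, hasGaugeIntegral_iff_apply]
  simp only [HasKSIntegral, Cell.diff, ← sub_smul, PiLp.smul_apply, smul_eq_mul, mul_comm]

lemma ksIntegrable_iff_apply {u : ℝ → Rn n} {h : ℝ → ℝ} :
    KSIntegrable u h a b ↔ ∀ i, ∃ I, HasKSIntegral (fun s => u s i) h a b I := by
  simp only [KSIntegrable, KurzweilIntegrable, hasKurzweilIntegral_smul_iff]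
  refine ⟨fun ⟨I, hI⟩ i => ⟨_, hI i⟩, fun H => ?_⟩
  choose I hI using H
  exact ⟨WithLp.toLp 1 I, hI⟩

lemma ksIntegral_eq (hab : a ≤ b) {u : ℝ → Rn n} {h : ℝ → ℝ} {I : Rn n}
    (H : ∀ i, HasKSIntegral (fun s => u s i) h a b (I i)) : ksIntegral u h a b = I :=
  (hasKurzweilIntegral_smul_iff.2 H).kurzweilIntegral_eq hab

lemma ksIntegral_self (u : ℝ → Rn n) (h : ℝ → ℝ) (a : ℝ) : ksIntegral u h a a = 0 :=
  ksIntegral_eq le_rfl fun _ => HasGaugeIntegral.self _ a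

lemma KSIntegrable.hasKSIntegral_apply {u : ℝ → Rn n} {h : ℝ → ℝ} (H : KSIntegrable u h a b)
    (i : Fin n) {s t : ℝ} (has : a ≤ s) (hst : s ≤ t) (htb : t ≤ b) :
    HasKSIntegral (fun r => u r i) h s t (ksIntegral u h a t i - ksIntegral u h a s i) := by
  choose G hGa hG using fun j => (ksIntegrable_iff_apply.1 H j).choose_spec.exists_indefinite
    (has.trans (hst.trans htb))
  have h_eq : ∀ r, a ≤ r → r ≤ b → ksIntegral u h a r i = G i r := fun r har hrb => by
    refine congrArg (fun y : Rn n => y i)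
      (ksIntegral_eq (I := WithLp.toLp 1 fun j => G j r) har fun j => ?_)
    simpa only [hGa, sub_zero] using hG j a r le_rfl har hrb
  rw [h_eq s has (hst.trans htb), h_eq t (has.trans hst) htb]
  exact hG i s t has hst htb

end Components

/-! ### Lebesgue integrable functions -/

section Lebesgue

variable {u w : ℝ → ℝ} {δ : ℝ → ℝ} {a b : ℝ}

lemma FinePartition.sum_tag_mul_diff_id_le_integral {l : List Cell} (H : FinePartition δ a b l)
    (hw : IntegrableOn w (Icc a b))
    (huw : ∀ᵐ s ∂volume.restrict (Icc a b), ∀ τ, |s - τ| < δ τ → u τ ≤ w s) :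
    (l.map fun p => u p.tag * p.diff id).sum ≤ ∫ s in a..b, w s := by
  have h_int : ∀ s t, a ≤ s → s ≤ t → t ≤ b → IntervalIntegrable w volume s t :=
    fun s t has hst htb => (intervalIntegrable_iff_integrableOn_Icc_of_le hst).2
      (hw.mono_set (Icc_subset_Icc has htb))
  have h_cell : ∀ p ∈ l, u p.tag * p.diff id ≤ p.diff fun t => ∫ s in a..t, w s := fun p hp => by
    have hp_in := H.isIn hp
    have h_le := hp_in.left_lt_right.le
    have h_diff : (p.diff fun t => ∫ s in a..t, w s) = ∫ s in p.left..p.right, w s :=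
      intervalIntegral.integral_interval_sub_left
        (h_int _ _ le_rfl hp_in.right_mem.1 hp_in.right_le)
        (h_int _ _ le_rfl hp_in.le_left hp_in.left_mem.2)
    rw [h_diff]
    calc u p.tag * p.diff id = ∫ _ in p.left..p.right, u p.tag := by
          rw [intervalIntegral.integral_const, smul_eq_mul, mul_comm, Cell.diff, id, id]
      _ ≤ ∫ s in p.left..p.right, w s := by
          refine intervalIntegral.integral_mono_ae_restrict h_le intervalIntegrable_const
            (h_int _ _ hp_in.le_left h_le hp_in.right_le) ?_
          filter_upwards [ae_mono (Measure.restrict_mono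
            (Icc_subset_Icc hp_in.le_left hp_in.right_le) le_rfl) huw,
            ae_restrict_mem measurableSet_Icc] with s hs hs_mem
          refine hs _ (lt_of_le_of_lt ?_ (H.right_sub_left_lt hp))
          rw [abs_le]
          rcases hp_in.tag_eq with h | h <;> constructor <;> linarith [hs_mem.1, hs_mem.2]
  calc (l.map fun p => u p.tag * p.diff id).sum
      ≤ (l.map fun p => p.diff fun t => ∫ s in a..t, w s).sum := List.sum_le_sum h_cell
    _ = ∫ s in a..b, w s := by
        rw [H.sum_map_diff, intervalIntegral.integral_same, sub_zero]

lemma eventually_sum_tag_mul_diff_id_le (hab : a ≤ b) (hu : IntegrableOn u (Icc a b)) {ε : ℝ}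
    (hε : 0 < ε) : ∀ᶠ l in fineFilter a b,
      (l.map fun p => u p.tag * p.diff id).sum ≤ (∫ s in a..b, u s) + ε := by
  -- Vitali–Carathéodory: a lower semicontinuous `w > u` stays above `u τ` near `τ`.
  obtain ⟨w, huw, hw, hw_int, hw_top, hwu⟩ := exists_lt_lowerSemicontinuous_integral_lt u hu hε
  have h_gauge : ∀ τ, ∃ δ > 0, ∀ s, |s - τ| < δ → (u τ : EReal) < w s := fun τ =>
    Metric.eventually_nhds_iff.1 (hw τ _ (huw τ))
  choose δ hδ_pos hδ using h_gauge
  filter_upwards [eventually_finePartition hδ_pos a b] with l hl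
  have h_le := hl.sum_tag_mul_diff_id_le_integral (u := u) hw_int <| by
    filter_upwards [hw_top] with s hs τ hτ
    have h_lt := hδ τ s hτ
    refine EReal.coe_le_coe_iff.1 ?_
    rw [EReal.coe_toReal hs.ne ((EReal.bot_lt_coe _).trans h_lt).ne']
    exact h_lt.le
  refine h_le.trans ?_
  rw [intervalIntegral.integral_of_le hab, intervalIntegral.integral_of_le hab,
    ← integral_Icc_eq_integral_Ioc, ← integral_Icc_eq_integral_Ioc]
  exact hwu.le

lemma hasKSIntegral_id_of_integrableOn (hab : a ≤ b) (hu : IntegrableOn u (Icc a b)) :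
    HasKSIntegral u id a b (∫ s in a..b, u s) := by
  refine Metric.tendsto_nhds.2 fun ε hε => ?_
  filter_upwards [eventually_sum_tag_mul_diff_id_le hab hu (half_pos hε),
    eventually_sum_tag_mul_diff_id_le hab hu.neg (half_pos hε)] with l h_upper h_lower
  have h_neg : (l.map fun p => (-u) p.tag * p.diff id).sum =
      -(l.map fun p => u p.tag * p.diff id).sum := by
    rw [← neg_one_mul (List.sum _), ← List.sum_map_mul_left]
    simp only [Pi.neg_apply, neg_mul, one_mul]
  have h_int_neg : ∫ s in a..b, (-u) s = -∫ s in a..b, u s := intervalIntegral.integral_neg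
  rw [h_neg, h_int_neg] at h_lower
  rw [Real.dist_eq, abs_lt]
  constructor <;> linarith

end Lebesgue

/-! ### Jumps of an indefinite integral -/

section Jumps

variable {u h G : ℝ → ℝ} {φ : Cell → ℝ} {a b : ℝ}

lemma HasGaugeIntegral.tendsto_first_cell (H : HasGaugeIntegral φ a b 0) (hab : a < b)
    (hφ : ∀ p : Cell, p.IsIn a b → 0 ≤ φ p) :
    Tendsto (fun t => φ ⟨a, a, t⟩) (𝓝[>] a) (𝓝 0) := by
  refine Metric.tendsto_nhds.2 fun ε hε => ?_
  obtain ⟨δ, hδ, H⟩ := eventually_fineFilter.1 (Metric.tendsto_nhds.1 H ε hε)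
  filter_upwards [Ioo_mem_nhdsGT (lt_min hab (lt_add_of_pos_right a (hδ a)))] with t ht
  obtain ⟨htb, htδ⟩ := lt_min_iff.1 ht.2
  obtain ⟨l, hl⟩ := exists_finePartition hδ htb.le
  have h_sum := H _ (.cons ht.1 (.inl rfl) (by linarith) hl)
  have h_cell := hφ ⟨a, a, t⟩ ⟨le_rfl, ht.1, htb.le, .inl rfl⟩
  have h_rest := hl.sum_map_nonneg fun p hp => hφ p (hp.mono ht.1.le le_rfl)
  rw [List.map_cons, List.sum_cons] at h_sum
  rw [Real.dist_eq, sub_zero, abs_of_nonneg (by linarith)] at *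
  linarith

lemma HasGaugeIntegral.tendsto_last_cell (H : HasGaugeIntegral φ a b 0) (hab : a < b)
    (hφ : ∀ p : Cell, p.IsIn a b → 0 ≤ φ p) :
    Tendsto (fun s => φ ⟨s, b, b⟩) (𝓝[<] b) (𝓝 0) := by
  refine Metric.tendsto_nhds.2 fun ε hε => ?_
  obtain ⟨δ, hδ, H⟩ := eventually_fineFilter.1 (Metric.tendsto_nhds.1 H ε hε)
  filter_upwards [Ioo_mem_nhdsLT (max_lt hab (sub_lt_self b (hδ b)))] with s hs
  obtain ⟨has, hsδ⟩ := max_lt_iff.1 hs.1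
  obtain ⟨l, hl⟩ := exists_finePartition hδ has.le
  have h_sum := H _ (hl.append (.cons hs.2 (.inr rfl) (by linarith) (.nil b)))
  have h_cell := hφ ⟨s, b, b⟩ ⟨has.le, hs.2, le_rfl, .inr rfl⟩
  have h_rest := hl.sum_map_nonneg fun p hp => hφ p (hp.mono le_rfl hs.2.le)
  rw [List.map_append, List.sum_append, List.map_singleton, List.sum_singleton] at h_sum
  rw [Real.dist_eq, sub_zero, abs_of_nonneg (by linarith)] at *
  linarith

lemma tendsto_indefinite_right
    (hG : ∀ s t, a ≤ s → s ≤ t → t ≤ b → HasKSIntegral u h s t (G t - G s)) (hab : a < b) :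
    Tendsto (fun t => G t - G a - u a * (h t - h a)) (𝓝[>] a) (𝓝 0) := by
  have h_cell := (saks_henstock hG hab.le).tendsto_first_cell hab fun _ _ => abs_nonneg _
  simpa only [Cell.diff, neg_sub, neg_zero] using
    ((tendsto_zero_iff_abs_tendsto_zero _).2 h_cell).neg

lemma continuousWithinAt_Iic_indefinite
    (hG : ∀ s t, a ≤ s → s ≤ t → t ≤ b → HasKSIntegral u h s t (G t - G s)) (hab : a < b)
    (hh : ContinuousWithinAt h (Iic b) b) : ContinuousWithinAt G (Iic b) b := by
  have h_cell := (tendsto_zero_iff_abs_tendsto_zero _).2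
    ((saks_henstock hG hab.le).tendsto_last_cell hab fun _ _ => abs_nonneg _)
  have h_jump : Tendsto (fun s => u b * (h b - h s)) (𝓝[<] b) (𝓝 (u b * (h b - h b))) :=
    ((hh.mono_left (nhdsWithin_mono _ Iio_subset_Iic_self)).const_sub (h b)).const_mul (u b)
  rw [← continuousWithinAt_Iio_iff_Iic]
  have h_lim := ((h_cell.sub h_jump).add_const (G b))
  simp only [sub_self, mul_zero, zero_add] at h_lim
  refine h_lim.congr fun s => ?_
  simp only [Cell.diff]
  ring

end Jumps

/-! ### The du Bois-Reymond lemma -/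

section DuBoisReymond

variable {u w φ χ : ℝ → ℝ} {a b : ℝ}

lemma integral_primitive_mul_deriv (hu : IntervalIntegrable u volume a b)
    (hφ : ContDiff ℝ 1 φ) (hφ_right : φ b = 0) :
    ∫ t in a..b, (∫ s in a..t, u s) * deriv φ t = -∫ t in a..b, u t * φ t := by
  have h_ac := hu.absolutelyContinuousOnInterval_intervalIntegral (left_mem_uIcc (a := a) (b := b))
  rw [h_ac.integral_mul_deriv_eq_deriv_mul hφ.contDiffOn.absolutelyContinuousOnInterval, hφ_right,
    intervalIntegral.integral_same, mul_zero, zero_mul, sub_zero, zero_sub, neg_inj]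
  refine intervalIntegral.integral_congr_ae ?_
  filter_upwards [hu.ae_hasDerivAt_integral] with t ht ht_mem
  rw [(ht (uIoc_subset_uIcc ht_mem) a left_mem_uIcc).deriv]

lemma iteratedDeriv_eq_zero_of_notMem_tsupport {t : ℝ} (ht : t ∉ tsupport χ) (j : ℕ) :
    iteratedDeriv j χ t = 0 := by
  rw [← norm_eq_zero, ← norm_iteratedFDeriv_eq_norm_iteratedDeriv, norm_eq_zero]
  exact Function.notMem_support.1 fun h => ht (support_iteratedFDeriv_subset j h)

lemma intervalIntegral_eq_zero_of_notMem_Ioo (hχ : Continuous χ)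
    (hχ_zero : ∀ t ∉ Ioo a b, χ t = 0) (hχ_int : ∫ t in a..b, χ t = 0) {t : ℝ}
    (ht : t ∉ Ioo a b) : ∫ s in a..t, χ s = 0 := by
  rcases le_or_gt t a with hta | hat
  · refine intervalIntegral.integral_zero_ae <|
      Eventually.of_forall fun s hs => hχ_zero s fun h => ?_
    rw [uIoc_of_ge hta] at hs
    exact h.1.not_ge hs.2
  · have hbt : b ≤ t := not_lt.1 fun h => ht ⟨hat, h⟩
    rw [← intervalIntegral.integral_add_adjacent_intervals (hχ.intervalIntegrable a b)
      (hχ.intervalIntegrable b t), hχ_int, zero_add]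
    refine intervalIntegral.integral_zero_ae <|
      Eventually.of_forall fun s hs => hχ_zero s fun h => ?_
    rw [uIoc_of_le hbt] at hs
    exact h.2.not_ge hs.1.le

lemma exists_contDiff_deriv_eq_of_integral_eq_zero (hχ : ContDiff ℝ ∞ χ)
    (hχ_supp : tsupport χ ⊆ Ioo a b) (hχ_int : ∫ t in a..b, χ t = 0) :
    ∃ φ : ℝ → ℝ, ContDiff ℝ ∞ φ ∧ (∀ j, ∀ t ∉ Ioo a b, iteratedDeriv j φ t = 0) ∧
      deriv φ = χ := by
  have h_deriv : ∀ t, HasDerivAt (fun t => ∫ s in a..t, χ s) (χ t) t := fun t =>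
    intervalIntegral.integral_hasDerivAt_right (hχ.continuous.intervalIntegrable _ _)
      hχ.continuous.aestronglyMeasurable.stronglyMeasurableAtFilter hχ.continuous.continuousAt
  have h_deriv_eq : deriv (fun t => ∫ s in a..t, χ s) = χ := funext fun t => (h_deriv t).deriv
  have h_notMem : ∀ t ∉ Ioo a b, t ∉ tsupport χ := fun t ht h => ht (hχ_supp h)
  refine ⟨_, contDiff_infty_iff_deriv.2 ⟨fun t => (h_deriv t).differentiableAt,
    by rwa [h_deriv_eq]⟩, ?_, h_deriv_eq⟩
  rintro (_ | j) t ht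
  · exact intervalIntegral_eq_zero_of_notMem_Ioo hχ.continuous
      (fun s hs => image_eq_zero_of_notMem_tsupport (h_notMem s hs)) hχ_int ht
  · rw [iteratedDeriv_succ', h_deriv_eq]
    exact iteratedDeriv_eq_zero_of_notMem_tsupport (h_notMem t ht) j

lemma intervalIntegral_eq_integral_of_tsupport_subset (hχ_supp : tsupport χ ⊆ Ioo a b) :
    ∫ t in a..b, χ t = ∫ t, χ t :=
  intervalIntegral.integral_eq_integral_of_support_subset
    ((subset_tsupport χ).trans (hχ_supp.trans Ioo_subset_Ioc_self))

lemma exists_contDiff_integral_eq_one (hab : a < b) :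
    ∃ ρ : ℝ → ℝ, ContDiff ℝ ∞ ρ ∧ tsupport ρ ⊆ Ioo a b ∧ ∫ t in a..b, ρ t = 1 := by
  let η : ContDiffBump ((a + b) / 2) :=
    ⟨(b - a) / 8, (b - a) / 4, by linarith, by linarith⟩
  have h_supp : tsupport (η.normed volume) ⊆ Ioo a b := by
    rw [η.tsupport_normed_eq, Real.closedBall_eq_Icc]
    refine Icc_subset_Ioo ?_ ?_
    · change a < (a + b) / 2 - (b - a) / 4
      linarith
    · change (a + b) / 2 + (b - a) / 4 < b
      linarith
  exact ⟨_, η.contDiff_normed, h_supp,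
    (intervalIntegral_eq_integral_of_tsupport_subset h_supp).trans η.integral_normed⟩

theorem ae_eq_const_of_integral_mul_deriv_eq_zero (hab : a < b)
    (hw : IntervalIntegrable w volume a b)
    (H : ∀ φ : ℝ → ℝ, ContDiff ℝ ∞ φ → (∀ j, ∀ t ∉ Ioo a b, iteratedDeriv j φ t = 0) →
      ∫ t in a..b, w t * deriv φ t = 0) :
    ∃ c, ∀ᵐ t, t ∈ Ioo a b → w t = c := by
  obtain ⟨ρ, hρ, hρ_supp, hρ_int⟩ := exists_contDiff_integral_eq_one hab
  set c := ∫ t in a..b, w t * ρ t with hc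
  have h_int : ∀ {ψ : ℝ → ℝ}, ContDiff ℝ ∞ ψ → IntervalIntegrable ψ volume a b :=
    fun hψ => hψ.continuous.intervalIntegrable _ _
  have h_int_mul : ∀ {ψ : ℝ → ℝ}, ContDiff ℝ ∞ ψ →
      IntervalIntegrable (fun t => w t * ψ t) volume a b :=
    fun hψ => hw.mul_continuousOn hψ.continuous.continuousOn
  have h_loc : LocallyIntegrableOn (fun t => w t - c) (Ioo a b) :=
    (((intervalIntegrable_iff_integrableOn_Ioc_of_le hab.le).1
      (hw.sub intervalIntegrable_const)).mono_set Ioo_subset_Ioc_self).locallyIntegrableOn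
  suffices h_zero : ∀ ψ : ℝ → ℝ, ContDiff ℝ ∞ ψ → tsupport ψ ⊆ Ioo a b →
      ∫ t in a..b, ψ t * (w t - c) = 0 by
    refine ⟨c, ?_⟩
    filter_upwards [isOpen_Ioo.ae_eq_zero_of_integral_contDiff_smul_eq_zero h_loc (μ := volume)
      fun ψ hψ _ hψ_supp => (intervalIntegral_eq_integral_of_tsupport_subset
        (tsupport_mul_subset_left.trans hψ_supp)).symm.trans (h_zero ψ hψ hψ_supp)] with t ht ht_mem
    exact sub_eq_zero.1 (ht ht_mem)
  intro ψ hψ hψ_supp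
  -- `ψ - (∫ ψ) ρ` has integral zero, so it is the derivative of a test function.
  obtain ⟨φ, hφ, hφ_zero, hφ_deriv⟩ := exists_contDiff_deriv_eq_of_integral_eq_zero
    (χ := fun t => ψ t - (∫ s in a..b, ψ s) * ρ t) (a := a) (b := b)
    (hψ.sub (contDiff_const.mul hρ))
    ((tsupport_sub _ _).trans (union_subset hψ_supp (tsupport_mul_subset_right.trans hρ_supp)))
    (by rw [intervalIntegral.integral_sub (h_int hψ) ((h_int hρ).const_mul _),
      intervalIntegral.integral_const_mul, hρ_int, mul_one, sub_self])
  calc ∫ t in a..b, ψ t * (w t - c)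
      = (∫ t in a..b, w t * ψ t) - (∫ s in a..b, ψ s) * c := by
        rw [← intervalIntegral.integral_mul_const,
          ← intervalIntegral.integral_sub (h_int_mul hψ) ((h_int hψ).mul_const c)]
        exact intervalIntegral.integral_congr fun t _ => by ring
    _ = ∫ t in a..b, w t * deriv φ t := by
        rw [hφ_deriv, hc, ← intervalIntegral.integral_const_mul,
          ← intervalIntegral.integral_sub (h_int_mul hψ) ((h_int_mul hρ).const_mul _)]
        exact intervalIntegral.integral_congr fun t _ => by ring
    _ = 0 := H φ hφ hφ_zero

lemma eq_const_of_ae_eq_const_of_leftContinuous {X : Type*} [TopologicalSpace X] [T1Space X]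
    {v : ℝ → X} {c : X} (hv : ∀ t ∈ Ioc a b, ContinuousWithinAt v (Iic t) t)
    (H : ∀ᵐ t, t ∈ Ioo a b → v t = c) : ∀ t ∈ Ioc a b, v t = c := by
  intro t ht
  have h_lim : Tendsto v (𝓝[<] t) (𝓝 (v t)) :=
    (hv t ht).mono_left (nhdsWithin_mono _ Iio_subset_Iic_self)
  refine isClosed_singleton.mem_of_frequently_of_tendsto (s := {c}) (frequently_iff.2 ?_) h_lim
  intro U hU
  obtain ⟨r, hr, hrU⟩ := mem_nhdsLT_iff_exists_Ioo_subset.1 hU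
  have h_freq : ∃ᵐ s ∂volume, s ∈ Ioo (max r a) t := by
    rw [frequently_ae_mem_iff, Real.volume_Ioo]
    simpa using max_lt hr ht.1
  obtain ⟨s, hs, hs_eq⟩ := (h_freq.and_eventually H).exists
  obtain ⟨hrs, has⟩ := max_lt_iff.1 hs.1
  exact ⟨s, hrU ⟨hrs, hs.2⟩, hs_eq ⟨has, hs.2.trans_le ht.2⟩⟩

end DuBoisReymond

/-! ### Indefinite integrals of vector functions -/

section BoundedVariation

lemma boundedVariationOn_add {E : Type*} [SeminormedAddCommGroup E] {u v : ℝ → E} {s : Set ℝ}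
    (hu : BoundedVariationOn u s) (hv : BoundedVariationOn v s) :
    BoundedVariationOn (fun t => u t + v t) s := by
  refine ne_top_of_le_ne_top (ENNReal.add_ne_top.2 ⟨hu, hv⟩) (iSup_le fun p => ?_)
  calc ∑ j ∈ Finset.range p.1, edist (u (p.2.1 (j + 1)) + v (p.2.1 (j + 1)))
        (u (p.2.1 j) + v (p.2.1 j))
      ≤ ∑ j ∈ Finset.range p.1, (edist (u (p.2.1 (j + 1))) (u (p.2.1 j)) +
          edist (v (p.2.1 (j + 1))) (v (p.2.1 j))) :=
        Finset.sum_le_sum fun _ _ => edist_add_add_le ..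
    _ ≤ eVariationOn u s + eVariationOn v s := by
        rw [Finset.sum_add_distrib]
        exact add_le_add (eVariationOn.sum_le p.2.2.1 p.2.2.2) (eVariationOn.sum_le p.2.2.1 p.2.2.2)

lemma integrableOn_Icc_of_boundedVariationOn {n : ℕ} {u : ℝ → Rn n} {a b : ℝ} (hab : a ≤ b)
    (hu : BoundedVariationOn u (Icc a b)) : IntegrableOn u (Icc a b) := by
  refine Integrable.of_eval_piLp fun i => ?_
  have h_apply : BoundedVariationOn (fun t => u t i) (Icc a b) :=
    (PiLp.proj (𝕜 := ℝ) 1 (fun _ : Fin n => ℝ) i).lipschitz.comp_boundedVariationOn hu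
  obtain ⟨p, q, hp, hq, h_eq⟩ :=
    h_apply.locallyBoundedVariationOn.exists_monotoneOn_sub_monotoneOn
  rw [← uIcc_of_le hab] at hp hq
  rw [h_eq]
  exact (intervalIntegrable_iff_integrableOn_Icc_of_le hab).1
    (hp.intervalIntegrable.sub hq.intervalIntegrable)

end BoundedVariation

section Indefinite

variable {n : ℕ} {u : ℝ → Rn n} {h V w : ℝ → ℝ} {a b M : ℝ}

lemma continuousWithinAt_Iic_ksIntegral (hu : KSIntegrable u h a b) {t : ℝ} (ht : t ∈ Ioc a b)
    (hh : ContinuousWithinAt h (Iic t) t) :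
    ContinuousWithinAt (ksIntegral u h a) (Iic t) t :=
  tendsto_Rn_iff.2 fun i => continuousWithinAt_Iic_indefinite
    (fun _ _ has hsr hrt => hu.hasKSIntegral_apply i has hsr (hrt.trans ht.2)) ht.1 hh

lemma tendsto_ksIntegral_sub_smul_right (hu : KSIntegrable u h a b) (hab : a < b) :
    Tendsto (fun t => ksIntegral u h a t - (h t - h a) • u a) (𝓝[>] a) (𝓝 0) := by
  refine tendsto_Rn_iff.2 fun i => ?_
  simpa only [ksIntegral_self, PiLp.zero_apply, sub_zero, PiLp.sub_apply, PiLp.smul_apply,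
    smul_eq_mul, mul_comm (u a i)] using tendsto_indefinite_right
      (fun _ _ has hst htb => hu.hasKSIntegral_apply i has hst htb) hab

lemma boundedVariationOn_ksIntegral (hV : IsVariationOn h V a b) (hab : a ≤ b)
    (hu : KSIntegrable u h a b) (hw : HasKSIntegral w V a b M)
    (huw : ∀ t ∈ Icc a b, ‖u t‖ ≤ w t) : BoundedVariationOn (ksIntegral u h a) (Icc a b) := by
  obtain ⟨W, -, hW⟩ := hw.exists_indefinite hab
  refine boundedVariationOn_of_dist_le (M := fun t => ∑ _ : Fin n, W t) fun s t has hst htb => ?_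
  rw [dist_comm, dist_eq_norm, PiLp.norm_eq_of_L1, ← Finset.sum_sub_distrib]
  exact Finset.sum_le_sum fun i _ => HasKSIntegral.abs_le (hV.mono has htb) hst
    (hu.hasKSIntegral_apply i has hst htb) (hW s t has hst htb) fun r hr =>
      (PiLp.norm_apply_le _ i).trans (huw r ⟨has.trans hr.1, hr.2.trans htb⟩)

lemma ksIntegrable_id_of_integrableOn (hab : a ≤ b) (hu : IntegrableOn u (Icc a b)) :
    KSIntegrable u id a b :=
  ksIntegrable_iff_apply.2 fun i => ⟨_, hasKSIntegral_id_of_integrableOn hab (hu.eval_piLp i)⟩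

lemma ksIntegral_id_apply (hu : IntegrableOn u (Icc a b)) {t : ℝ} (ht : t ∈ Icc a b)
    (i : Fin n) : ksIntegral u id a t i = ∫ s in a..t, u s i :=
  congrArg (fun y : Rn n => y i) <| ksIntegral_eq
    (I := WithLp.toLp 1 fun i => ∫ s in a..t, u s i) ht.1 fun i =>
      hasKSIntegral_id_of_integrableOn ht.1
        ((hu.mono_set (Icc_subset_Icc_right ht.2)).eval_piLp i)

lemma boundedVariationOn_ksIntegral_id (hab : a ≤ b) (hu : IntegrableOn u (Icc a b)) :
    BoundedVariationOn (ksIntegral u id a) (Icc a b) :=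
  boundedVariationOn_ksIntegral (isVariationOn_of_monotoneOn (monotone_id.monotoneOn _)) hab
    (ksIntegrable_id_of_integrableOn hab hu) (hasKSIntegral_id_of_integrableOn hab hu.norm)
    fun _ _ => le_rfl

end Indefinite

/-! ### Superposition operators -/

section Superposition

variable {n : ℕ} {Ω : Set (Rn n)} {x : ℝ → Rn n} {k : Rn n → ℝ → Rn n} {h V w : ℝ → ℝ} {a b M : ℝ}

lemma continuousWithinAt_superposition (hxΩ : ∀ t ∈ Icc a b, x t ∈ Ω)
    (hk : ∀ t ∈ Icc a b, ContinuousOn (fun y => k y t) Ω) {s : ℝ} (hs : s ∈ Icc a b)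
    (hxs : ContinuousAt x s) : ContinuousWithinAt (fun τ => k (x τ) s) (Icc a b) s :=
  (hk s hs (x s) (hxΩ s hs)).comp hxs.continuousWithinAt hxΩ

theorem hasKurzweilIntegral_superposition (hV : IsVariationOn h V a b) (hab : a ≤ b)
    (h_left : ∀ t ∈ Ioc a b, ContinuousWithinAt h (Iic t) t)
    (hx : {t ∈ Icc a b | ¬ContinuousAt x t}.Countable) (hxΩ : ∀ t ∈ Icc a b, x t ∈ Ω)
    (hk : ∀ t ∈ Icc a b, ContinuousOn (fun y => k y t) Ω)
    (hk_int : ∀ y ∈ Ω, KSIntegrable (k y) h a b) (hw : HasKSIntegral w V a b M)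
    (hkw : ∀ y ∈ Ω, ∀ t ∈ Icc a b, ‖k y t‖ ≤ w t) :
    KSIntegrable (fun t => k (x t) t) h a b ∧ ∀ c ∈ Icc a b,
      HasKurzweilIntegral (fun τ t => ksIntegral (k (x τ)) h a t) a c
        (ksIntegral (fun t => k (x t) t) h a c) := by
  obtain ⟨W, -, hW⟩ := hw.exists_indefinite hab
  have h_diag : ∀ c ∈ Icc a b, ∀ i, ∃ I, HasKSIntegral (fun s => k (x s) s i) h a c I ∧
      HasGaugeIntegral (fun p => p.diff fun t => ksIntegral (k (x p.tag)) h a t i) a c I := by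
    intro c hc i
    have h_mem : ∀ {t}, t ∈ Icc a c → t ∈ Icc a b := fun ht => ⟨ht.1, ht.2.trans hc.2⟩
    exact exists_hasKSIntegral_diagonal (k := fun τ s => k (x τ) s i)
      (K := fun τ t => ksIntegral (k (x τ)) h a t i) (hV.mono le_rfl hc.2) hc.1
      (fun t ht => h_left t ⟨ht.1, ht.2.trans hc.2⟩)
      (fun τ hτ s t has hst htc =>
        (hk_int _ (hxΩ τ (h_mem hτ))).hasKSIntegral_apply i has hst (htc.trans hc.2))
      (hW a c le_rfl hc.1 hc.2)
      (fun τ hτ s hs => (PiLp.norm_apply_le _ i).trans (hkw _ (hxΩ τ (h_mem hτ)) s (h_mem hs)))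
      hx fun s hs hs_cont => tendsto_Rn_iff.1
        ((continuousWithinAt_superposition hxΩ hk (h_mem hs)
          (not_not.1 fun h_disc => hs_cont ⟨h_mem hs, h_disc⟩)).mono (Icc_subset_Icc_right hc.2)) i
  refine ⟨ksIntegrable_iff_apply.2 fun i => ?_, fun c hc => ?_⟩
  · obtain ⟨I, hI, -⟩ := h_diag b (right_mem_Icc.2 hab) i
    exact ⟨I, hI⟩
  · choose I hI hI_gauge using h_diag c hc
    rw [ksIntegral_eq (I := WithLp.toLp 1 I) hc.1 hI, hasKurzweilIntegral_iff_hasGaugeIntegral,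
      hasGaugeIntegral_iff_apply]
    exact hI_gauge

lemma integrableOn_superposition (hab : a ≤ b) (hx : {t ∈ Icc a b | ¬ContinuousAt x t}.Countable)
    (hxΩ : ∀ t ∈ Icc a b, x t ∈ Ω) (hk : ∀ t ∈ Icc a b, ContinuousOn (fun y => k y t) Ω)
    (hk_meas : ∀ y ∈ Ω, AEStronglyMeasurable (k y) (volume.restrict (Icc a b)))
    (hw : IntegrableOn w (Icc a b)) (hkw : ∀ y ∈ Ω, ∀ t ∈ Icc a b, ‖k y t‖ ≤ w t) :
    IntegrableOn (fun t => k (x t) t) (Icc a b) := by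
  refine hw.mono' (aestronglyMeasurable_diagonal (k := fun τ => k (x τ)) hab
    (fun τ hτ => hk_meas _ (hxΩ τ hτ)) hx fun s hs hs_cont =>
      continuousWithinAt_superposition hxΩ hk hs
        (not_not.1 fun h_disc => hs_cont ⟨hs, h_disc⟩)) ?_
  filter_upwards [ae_restrict_mem measurableSet_Icc] with t ht using hkw _ (hxΩ t ht) t ht

end Superposition

/-! ### Test functions and distributional derivatives -/

section Distributions

variable {n : ℕ} {T : ℝ} {u v x : ℝ → Rn n} {h : ℝ → ℝ}

lemma TestFun.apply_eq_zero (φ : TestFun n T) {t : ℝ} (ht : t ∉ Ioo 0 T) (i : Fin n) :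
    φ.toFun t i = 0 := by
  rw [← iteratedDeriv_zero (f := φ.toFun), φ.vanish 0 t ht, PiLp.zero_apply]

lemma TestFun.contDiff_apply (φ : TestFun n T) (i : Fin n) : ContDiff ℝ ∞ fun t => φ.toFun t i :=
  (PiLp.proj (𝕜 := ℝ) 1 (fun _ : Fin n => ℝ) i).contDiff.comp φ.smooth

lemma TestFun.hasDerivAt_apply (φ : TestFun n T) (i : Fin n) (t : ℝ) :
    HasDerivAt (fun t => φ.toFun t i) (φ.derivative.toFun t i) t :=
  (PiLp.proj (𝕜 := ℝ) 1 (fun _ : Fin n => ℝ) i).hasFDerivAt.comp_hasDerivAt t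
    (φ.smooth.differentiable (by simp) t).hasDerivAt

/-- The test function `φ eᵢ`, whose only nonzero component is `φ`; pairing with it reads off the
`i`-th component of a distribution. -/
noncomputable def TestFun.single (i : Fin n) (φ : ℝ → ℝ) (hφ : ContDiff ℝ ∞ φ)
    (hφ_zero : ∀ j, ∀ t ∉ Ioo 0 T, iteratedDeriv j φ t = 0) : TestFun n T where
  toFun t := φ t • PiLp.single 1 i (1 : ℝ)
  smooth := hφ.smul contDiff_const
  vanish j t ht := by
    rw [iteratedDeriv_smul_const (hφ.contDiffAt.of_le (by exact_mod_cast le_top)),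
      hφ_zero j t ht, zero_smul]

lemma distDeriv_ofFun_single {i : Fin n} {φ : ℝ → ℝ} (hφ : ContDiff ℝ ∞ φ)
    (hφ_zero : ∀ j, ∀ t ∉ Ioo 0 T, iteratedDeriv j φ t = 0) :
    distDeriv (ofFun T u) (.single i φ hφ hφ_zero) = -∫ t in (0 : ℝ)..T, u t i * deriv φ t := by
  have h_deriv : ∀ t, (TestFun.single i φ hφ hφ_zero).derivative.toFun t =
      deriv φ t • PiLp.single 1 i (1 : ℝ) := fun t =>
    deriv_smul_const (hφ.differentiable (by simp) t) _
  simp [distDeriv, ofFun, h_deriv]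

lemma intervalIntegrable_apply_mul (hT : 0 ≤ T) (hu : IntegrableOn u (Icc 0 T))
    (φ : TestFun n T) (i : Fin n) :
    IntervalIntegrable (fun t => u t i * φ.toFun t i) volume 0 T :=
  ((intervalIntegrable_iff_integrableOn_Icc_of_le hT).2 (hu.eval_piLp i)).mul_continuousOn
    (φ.contDiff_apply i).continuous.continuousOn

lemma ofFun_eq_sum (hT : 0 ≤ T) (hu : IntegrableOn u (Icc 0 T)) (φ : TestFun n T) :
    ofFun T u φ = ∑ i, ∫ t in (0 : ℝ)..T, u t i * φ.toFun t i :=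
  intervalIntegral.integral_finsetSum fun i _ => intervalIntegrable_apply_mul hT hu φ i

lemma distDeriv_ofFun_sub (hT : 0 ≤ T) (hu : IntegrableOn u (Icc 0 T))
    (hv : IntegrableOn v (Icc 0 T)) (φ : TestFun n T) :
    distDeriv (ofFun T (u - v)) φ =
      distDeriv (ofFun T u) φ - distDeriv (ofFun T v) φ := by
  have h_sub : ofFun T (u - v) φ.derivative =
      ofFun T u φ.derivative - ofFun T v φ.derivative := by
    rw [ofFun_eq_sum hT (hu.sub hv), ofFun_eq_sum hT hu, ofFun_eq_sum hT hv,
      ← Finset.sum_sub_distrib]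
    refine Finset.sum_congr rfl fun i _ => ?_
    rw [← intervalIntegral.integral_sub (intervalIntegrable_apply_mul hT hu _ i)
      (intervalIntegrable_apply_mul hT hv _ i)]
    simp only [Pi.sub_apply, PiLp.sub_apply, sub_mul]
  rw [distDeriv, distDeriv, distDeriv, h_sub]
  ring

lemma distDeriv_ofFun_ksIntegral_id (hT : 0 ≤ T) (hu : IntegrableOn u (Icc 0 T))
    (φ : TestFun n T) : distDeriv (ofFun T (ksIntegral u id 0)) φ = ofFun T u φ := by
  have h_prim : IntegrableOn (ksIntegral u id 0) (Icc 0 T) :=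
    integrableOn_Icc_of_boundedVariationOn hT (boundedVariationOn_ksIntegral_id hT hu)
  rw [distDeriv, ofFun_eq_sum hT h_prim, ofFun_eq_sum hT hu, ← Finset.sum_neg_distrib]
  refine Finset.sum_congr rfl fun i _ => ?_
  have h_parts := integral_primitive_mul_deriv
    ((intervalIntegrable_iff_integrableOn_Icc_of_le hT).2 (hu.eval_piLp i))
    ((φ.contDiff_apply i).of_le (by exact_mod_cast le_top)) (φ.apply_eq_zero (by simp) i)
  rw [← neg_eq_iff_eq_neg.2 h_parts, neg_inj]
  refine intervalIntegral.integral_congr fun t ht => ?_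
  rw [uIcc_of_le hT] at ht
  beta_reduce
  rw [ksIntegral_id_apply hu ht, (φ.hasDerivAt_apply i t).deriv]

lemma distDeriv_ofFun_eq_zero_of_eq_const (hT : 0 ≤ T) {c : Rn n} (hu : ∀ t ∈ Ioc 0 T, u t = c)
    (φ : TestFun n T) : distDeriv (ofFun T u) φ = 0 := by
  have h_const : ofFun T u φ.derivative = ofFun T (fun _ => c) φ.derivative :=
    intervalIntegral.integral_congr_ae (Eventually.of_forall fun t ht => by
      rw [uIoc_of_le hT] at ht
      simp only [hu t ht])
  rw [distDeriv, h_const, ofFun_eq_sum hT (integrableOn_const measure_Icc_lt_top.ne), neg_eq_zero]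
  refine Finset.sum_eq_zero fun i _ => ?_
  rw [intervalIntegral.integral_const_mul, intervalIntegral.integral_eq_sub_of_hasDerivAt
    (fun t _ => φ.hasDerivAt_apply i t)
    ((φ.derivative.contDiff_apply i).continuous.intervalIntegrable _ _),
    φ.apply_eq_zero (by simp), φ.apply_eq_zero (by simp), sub_zero, mul_zero]

theorem distDeriv_ofFun_eq_zero_iff (hT : 0 < T) (hu : IntegrableOn u (Icc 0 T))
    (hu_left : ∀ t ∈ Ioc 0 T, ContinuousWithinAt u (Iic t) t) :
    (∀ φ, distDeriv (ofFun T u) φ = 0) ↔ ∃ c, ∀ t ∈ Ioc 0 T, u t = c := by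
  refine ⟨fun H => ?_, fun ⟨_, hc⟩ => distDeriv_ofFun_eq_zero_of_eq_const hT.le hc⟩
  have h_apply : ∀ i, ∃ c, ∀ᵐ t, t ∈ Ioo 0 T → u t i = c := fun i =>
    ae_eq_const_of_integral_mul_deriv_eq_zero hT
      ((intervalIntegrable_iff_integrableOn_Icc_of_le hT.le).2 (hu.eval_piLp i))
      fun φ hφ hφ_zero => by
        rw [← neg_eq_zero, ← distDeriv_ofFun_single hφ hφ_zero]
        exact H _
  choose c hc using h_apply
  refine ⟨WithLp.toLp 1 c, fun t ht => PiLp.ext fun i => ?_⟩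
  exact eq_const_of_ae_eq_const_of_leftContinuous
    (fun t ht => tendsto_Rn_iff.1 (hu_left t ht) i) (hc i) t ht

end Distributions

/-! ### Reduction to the integral equation -/

section IntegralEquation

variable {n : ℕ} {T : ℝ} {u v x : ℝ → Rn n} {h : ℝ → ℝ}

lemma distributional_equation_iff (hT : 0 < T) (hx : BoundedVariationOn x (Icc 0 T))
    (hx_left : ∀ t ∈ Ioc 0 T, ContinuousWithinAt x (Iic t) t)
    (h_left : ∀ t ∈ Ioc 0 T, ContinuousWithinAt h (Iic t) t)
    (hu : IntegrableOn u (Icc 0 T)) (hv : KSIntegrable v h 0 T)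
    (hv_bv : BoundedVariationOn (ksIntegral v h 0) (Icc 0 T)) :
    (∀ φ : TestFun n T, distDeriv (ofFun T x) φ = ofFun T u φ + mulDeriv T v h φ) ↔
      ∃ c, ∀ t ∈ Ioc 0 T, x t - ksIntegral u id 0 t - ksIntegral v h 0 t = c := by
  have hx_int := integrableOn_Icc_of_boundedVariationOn hT.le hx
  have hΦ_int := integrableOn_Icc_of_boundedVariationOn hT.le
    (boundedVariationOn_ksIntegral_id hT.le hu)
  have hΨ_int := integrableOn_Icc_of_boundedVariationOn hT.le hv_bv
  refine (forall_congr' fun φ => ?_).trans (distDeriv_ofFun_eq_zero_iff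
    (u := x - ksIntegral u id 0 - ksIntegral v h 0) hT ((hx_int.sub hΦ_int).sub hΨ_int)
    fun t ht => ((hx_left t ht).sub (continuousWithinAt_Iic_ksIntegral
      (ksIntegrable_id_of_integrableOn hT.le hu) ht continuousWithinAt_id)).sub
      (continuousWithinAt_Iic_ksIntegral hv ht (h_left t ht)))
  rw [distDeriv_ofFun_sub hT.le (hx_int.sub hΦ_int) hΨ_int,
    distDeriv_ofFun_sub hT.le hx_int hΦ_int, distDeriv_ofFun_ksIntegral_id hT.le hu, mulDeriv,
    sub_sub, sub_eq_zero]

lemma tendsto_jump_iff (hT : 0 < T) (hu : IntegrableOn u (Icc 0 T)) (hv : KSIntegrable v h 0 T) :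
    Tendsto (fun t => x t - x 0 - (h t - h 0) • v 0) (𝓝[>] 0) (𝓝 0) ↔
      Tendsto (fun t => x t - ksIntegral u id 0 t - ksIntegral v h 0 t) (𝓝[>] 0) (𝓝 (x 0)) := by
  have h_id : Tendsto (fun t : ℝ => (id t - id 0) • u 0) (𝓝[>] 0) (𝓝 0) := by
    have h_cont : Continuous fun t : ℝ => (id t - id 0) • u 0 := by fun_prop
    simpa using (h_cont.tendsto 0).mono_left nhdsWithin_le_nhds
  have hΦ := (tendsto_ksIntegral_sub_smul_right
    (ksIntegrable_id_of_integrableOn hT.le hu) hT).add h_id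
  have hΨ := tendsto_ksIntegral_sub_smul_right hv hT
  have h_rest := (hΦ.add hΨ).sub_const (x 0)
  simp only [sub_add_cancel, add_zero, zero_sub] at h_rest
  constructor <;> intro H
  · simpa using (H.sub h_rest).congr fun t => by abel
  · simpa using (H.add h_rest).congr fun t => by abel

lemma exists_eq_const_and_tendsto_iff {X : Type*} [TopologicalSpace X] [T2Space X] {r : ℝ → X}
    {a b : ℝ} {y : X} (hab : a < b) :
    ((∃ c, ∀ t ∈ Ioc a b, r t = c) ∧ Tendsto r (𝓝[>] a) (𝓝 y)) ↔ ∀ t ∈ Ioc a b, r t = y := by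
  have h_lim : ∀ {c}, (∀ t ∈ Ioc a b, r t = c) → Tendsto r (𝓝[>] a) (𝓝 c) := fun hc =>
    tendsto_const_nhds.congr' <| by
      filter_upwards [Ioc_mem_nhdsGT hab] with t ht using (hc t ht).symm
  refine ⟨fun ⟨⟨c, hc⟩, hy⟩ => ?_, fun H => ⟨⟨y, H⟩, h_lim H⟩⟩
  rwa [tendsto_nhds_unique hy (h_lim hc)]

lemma equation_and_jump_iff (hT : 0 < T) (hx : BoundedVariationOn x (Icc 0 T))
    (hx_left : ∀ t ∈ Ioc 0 T, ContinuousWithinAt x (Iic t) t)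
    (h_left : ∀ t ∈ Ioc 0 T, ContinuousWithinAt h (Iic t) t)
    (hu : IntegrableOn u (Icc 0 T)) (hv : KSIntegrable v h 0 T)
    (hv_bv : BoundedVariationOn (ksIntegral v h 0) (Icc 0 T)) :
    (∀ φ : TestFun n T, distDeriv (ofFun T x) φ = ofFun T u φ + mulDeriv T v h φ) ∧
        Tendsto (fun t => x t - x 0 - (h t - h 0) • v 0) (𝓝[>] 0) (𝓝 0) ↔
      ∀ t ∈ Icc 0 T, x t = x 0 + (ksIntegral u id 0 t + ksIntegral v h 0 t) := by
  rw [distributional_equation_iff hT hx hx_left h_left hu hv hv_bv, tendsto_jump_iff hT hu hv,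
    exists_eq_const_and_tendsto_iff hT, ← Ioc_insert_left hT.le, forall_mem_insert,
    ksIntegral_self, ksIntegral_self, add_zero, add_zero, and_iff_right rfl]
  simp only [sub_sub, sub_eq_iff_eq_add]

lemma leftContinuous_of_eq_add_ksIntegral (hT : 0 ≤ T)
    (h_left : ∀ t ∈ Ioc 0 T, ContinuousWithinAt h (Iic t) t)
    (hu : IntegrableOn u (Icc 0 T)) (hv : KSIntegrable v h 0 T)
    (H : ∀ t ∈ Icc 0 T, x t = x 0 + (ksIntegral u id 0 t + ksIntegral v h 0 t)) :
    ∀ t ∈ Ioc 0 T, ContinuousWithinAt x (Iic t) t := by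
  intro t ht
  refine (((continuousWithinAt_Iic_ksIntegral (ksIntegrable_id_of_integrableOn hT hu) ht
    continuousWithinAt_id).add (continuousWithinAt_Iic_ksIntegral hv ht (h_left t ht))).const_add
    (x 0)).congr_of_eventuallyEq ?_ (H t ⟨ht.1.le, ht.2⟩)
  filter_upwards [Ioc_mem_nhdsLE ht.1] with s hs using H s ⟨hs.1.le, hs.2.trans ht.2⟩

lemma boundedVariationOn_of_eq_add_ksIntegral (hT : 0 ≤ T) (hu : IntegrableOn u (Icc 0 T))
    (hv_bv : BoundedVariationOn (ksIntegral v h 0) (Icc 0 T))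
    (H : ∀ t ∈ Icc 0 T, x t = x 0 + (ksIntegral u id 0 t + ksIntegral v h 0 t)) :
    BoundedVariationOn x (Icc 0 T) := by
  have h_translate : LipschitzWith 1 (x 0 + ·) := (isometry_add_left (x 0)).lipschitz
  rw [BoundedVariationOn, eVariationOn.congr H]
  exact h_translate.comp_boundedVariationOn
    (boundedVariationOn_add (boundedVariationOn_ksIntegral_id hT hu) hv_bv)

variable {Λ : Set ℝ} {Ω : Set (Rn n)} {f : ℝ → Rn n → ℝ → Rn n} {g : Rn n → ℝ → Rn n} {lam : ℝ}

theorem isMDESolution_and_initialJump_iff (hT : 0 < T) (hlam : lam ∈ Λ)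
    (hxΩ : ∀ t ∈ Icc 0 T, x t ∈ Ω) (h_left : ∀ t ∈ Ioc 0 T, ContinuousWithinAt h (Iic t) t)
    (hf : IntegrableOn (fun t => f lam (x t) t) (Icc 0 T))
    (hg : KSIntegrable (fun t => g (x t) t) h 0 T)
    (hg_bv : BoundedVariationOn (ksIntegral (fun t => g (x t) t) h 0) (Icc 0 T)) :
    IsMDESolution T Λ Ω f g h x lam ∧ InitialJump g h x ↔
      ∀ t ∈ Icc 0 T, x t = x 0 + (ksIntegral (fun t => f lam (x t) t) id 0 t +
        ksIntegral (fun t => g (x t) t) h 0 t) := by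
  constructor
  · rintro ⟨H, H_jump⟩
    exact (equation_and_jump_iff hT H.boundedVariation H.leftContinuous h_left hf hg hg_bv).1
      ⟨H.equation, H_jump⟩
  · intro H
    have hx_bv := boundedVariationOn_of_eq_add_ksIntegral hT.le hf hg_bv H
    have hx_left := leftContinuous_of_eq_add_ksIntegral hT.le h_left hf hg H
    obtain ⟨h_eq, h_jump⟩ := (equation_and_jump_iff hT hx_bv hx_left h_left hf hg hg_bv).2 H
    exact ⟨⟨hlam, hx_bv, hx_left, hxΩ, hf, hg, h_eq⟩, h_jump⟩

theorem isGODESolution_rhs_iff (hlam : lam ∈ Λ) (hx : RegulatedOn x T)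
    (hxΩ : ∀ t ∈ Icc 0 T, x t ∈ Ω)
    (hf : ∀ t ∈ Icc 0 T, HasKurzweilIntegral (fun τ t => ksIntegral (f lam (x τ)) id 0 t) 0 t
      (ksIntegral (fun t => f lam (x t) t) id 0 t))
    (hg : ∀ t ∈ Icc 0 T, HasKurzweilIntegral (fun τ t => ksIntegral (g (x τ)) h 0 t) 0 t
      (ksIntegral (fun t => g (x t) t) h 0 t)) :
    IsGODESolution T Λ Ω (rhs f g h) x lam ↔
      ∀ t ∈ Icc 0 T, x t = x 0 + (ksIntegral (fun t => f lam (x t) t) id 0 t +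
        ksIntegral (fun t => g (x t) t) h 0 t) := by
  have h_rhs := fun t ht => (hf t ht).add (hg t ht)
  refine ⟨fun H t ht => ?_, fun H => ⟨hlam, hx, hxΩ, fun t ht => ?_⟩⟩
  · rw [← (H.equation t ht).unique ht.1 (h_rhs t ht), add_sub_cancel]
  · rw [H t ht, add_sub_cancel_left]
    exact h_rhs t ht

end IntegralEquation

end MDE

open MDE in
theorem mainTheorem9_general (n : ℕ) (T : ℝ) (hT : 0 < T) (Λ : Set ℝ) (Ω : Set (Rn n))
    (f : ℝ → Rn n → ℝ → Rn n) (g : Rn n → ℝ → Rn n) (h : ℝ → ℝ)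
    (h_left : ∀ t ∈ Ioc 0 T, ContinuousWithinAt h (Iic t) t)
    (h_bv : BoundedVariationOn h (Icc 0 T))
    (f_cont : ∀ lam ∈ Λ, ∀ t ∈ Icc 0 T, ContinuousOn (fun x => f lam x t) Ω)
    (f_meas : ∀ lam ∈ Λ, ∀ x ∈ Ω,
      AEStronglyMeasurable (fun t => f lam x t) (volume.restrict (Icc 0 T)))
    (f_bound : ∃ m : ℝ → ℝ, IntegrableOn m (Icc 0 T) ∧
      ∀ lam ∈ Λ, ∀ x ∈ Ω, ∀ t ∈ Icc 0 T, ‖f lam x t‖ ≤ m t)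
    (g_cont : ∀ t ∈ Icc 0 T, ContinuousOn (fun x => g x t) Ω)
    (g_bound : ∃ m : ℝ → ℝ,
      KSIntegrable m (fun t => (eVariationOn h (Icc 0 t)).toReal) 0 T ∧
      ∀ x ∈ Ω, ∀ t ∈ Icc 0 T, ‖g x t‖ ≤ m t)
    (g_int : ∀ x ∈ Ω, KSIntegrable (fun t => g x t) h 0 T)
    (x : ℝ → Rn n) (hx : RegulatedOn x T) (lam : ℝ) (hlam : lam ∈ Λ) :
    IsMDESolution T Λ Ω f g h x lam ∧ InitialJump g h x ↔
      IsGODESolution T Λ Ω (rhs f g h) x lam := by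
  by_cases hxΩ : ∀ t ∈ Icc 0 T, x t ∈ Ω
  swap
  · exact ⟨fun H => absurd H.1.mem hxΩ, fun H => absurd H.mem hxΩ⟩
  obtain ⟨m, hm, hfm⟩ := f_bound
  obtain ⟨w, hw, hgw⟩ := g_bound
  obtain ⟨M, hM⟩ := hw.exists_hasKSIntegral
  have hV := isVariationOn_toReal_eVariationOn h_bv
  have hD := hx.countable_not_continuousAt
  have hf_int : ∀ y ∈ Ω, IntegrableOn (f lam y) (Icc 0 T) := fun y hy =>
    hm.mono' (f_meas lam hlam y hy)
      ((ae_restrict_mem measurableSet_Icc).mono fun t ht => hfm lam hlam y hy t ht)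
  obtain ⟨-, hf_kurzweil⟩ := hasKurzweilIntegral_superposition
    (isVariationOn_of_monotoneOn (monotone_id.monotoneOn _)) hT.le
    (fun _ _ => continuousWithinAt_id) hD hxΩ (f_cont lam hlam)
    (fun y hy => ksIntegrable_id_of_integrableOn hT.le (hf_int y hy))
    (hasKSIntegral_id_of_integrableOn hT.le hm) (hfm lam hlam)
  obtain ⟨hg, hg_kurzweil⟩ := hasKurzweilIntegral_superposition hV hT.le h_left hD hxΩ g_cont
    g_int hM hgw
  rw [isGODESolution_rhs_iff hlam hx hxΩ hf_kurzweil hg_kurzweil]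
  exact isMDESolution_and_initialJump_iff hT hlam hxΩ h_left
    (integrableOn_superposition hT.le hD hxΩ (f_cont lam hlam) (f_meas lam hlam) hm (hfm lam hlam))
    hg (boundedVariationOn_ksIntegral hV hT.le hg hM fun t ht => hgw _ (hxΩ t ht) t ht)

theorem mainTheorem9 (n : ℕ) (T : ℝ) (hT : 0 < T)
    (Λ : Set ℝ) (hΛ : IsOpen Λ) (Ω : Set (MDE.Rn n)) (hΩ : IsOpen Ω)
    (f : ℝ → MDE.Rn n → ℝ → MDE.Rn n) (g : MDE.Rn n → ℝ → MDE.Rn n) (h : ℝ → ℝ)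
    -- `h` is left-continuous on `(-∞, T]`, of bounded variation on `[0, T]`, constant on `(-∞, 0]`
    (h_left : ∀ t ≤ T, ContinuousWithinAt h (Iic t) t)
    (h_bv : BoundedVariationOn h (Icc 0 T))
    (h_const : ∀ t < 0, h t = h 0)
    -- Caratheodory conditions on `f`
    (f_cont : ∀ lam ∈ Λ, ∀ t ∈ Icc 0 T, ContinuousOn (fun x => f lam x t) Ω)
    (f_meas : ∀ lam ∈ Λ, ∀ x ∈ Ω,
      AEStronglyMeasurable (fun t => f lam x t) (volume.restrict (Icc 0 T)))
    (f_bound : ∃ m : ℝ → ℝ, (∀ t ∈ Icc 0 T, 0 ≤ m t) ∧ IntegrableOn m (Icc 0 T) ∧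
      ∀ lam ∈ Λ, ∀ x ∈ Ω, ∀ t ∈ Icc 0 T, ‖f lam x t‖ ≤ m t)
    -- conditions on `g`
    (g_cont : ∀ t ∈ Icc 0 T, ContinuousOn (fun x => g x t) Ω)
    (g_bound : ∃ m : ℝ → ℝ, (∀ t ∈ Icc 0 T, 0 ≤ m t) ∧
      MDE.KSIntegrable m (fun t => (eVariationOn h (Icc 0 t)).toReal) 0 T ∧
      ∀ x ∈ Ω, ∀ t ∈ Icc 0 T, ‖g x t‖ ≤ m t)
    -- the integrals `∫ g(x, s) dh(s)` defining `F` exist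
    (g_int : ∀ x ∈ Ω, MDE.KSIntegrable (fun t => g x t) h 0 T)
    (x : ℝ → MDE.Rn n) (hx : MDE.RegulatedOn x T) (lam : ℝ) (hlam : lam ∈ Λ) :
    MDE.IsMDESolution T Λ Ω f g h x lam ∧ MDE.InitialJump g h x ↔
      MDE.IsGODESolution T Λ Ω (MDE.rhs f g h) x lam :=
  mainTheorem9_general n T hT Λ Ω f g h (fun t ht => h_left t ht.2) h_bv f_cont f_meas
    (f_bound.imp fun _ H => H.2) g_cont (g_bound.imp fun _ H => H.2) g_int x hx lam hlam
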